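/- Let $N\ge 2$, let $\mathcal E$ be the space of $N\times N$ complex Hermitian matrices with the norm $\|A\|^2=\operatorname{Tr}(A^2)$, and for $A\in\mathcal E$ let $\lambda_1(A)\le\dots\le\lambda_N(A)$ be its eigenvalues, repeated according to multiplicity. Let $\mathbb T^2=\mathbb R^2/(2\pi\mathbb Z)^2$, let $n\in\{1,\dots,N-1\}$, and let $H_0,H_1\in C^\infty(\mathbb T^2,\mathcal E)$ satisfy $$\lambda_n(H_0(\xi))<\lambda_{n+1}(H_0(\xi)),\qquad \lambda_n(H_1(\xi))<\lambda_{n+1}(H_1(\xi))\qquad\text{for all }\xi\in\mathbb T^2.$$ Let $C^\infty([0,1]\times\mathbb T^2,\mathcal E)$ be the space of functions that are smooth on $(0,1)\times\mathbb T^2$ and whose derivatives of all orders (including order $0$) extend continuously to $[0,1]\times\mathbb T^2$, with the distance $$d(H,\widetilde H)=\sum_{k=0}^\infty 2^{-k}\frac{\|H-\widetilde H\|_{C^k}}{1+\|H-\widetilde H\|_{C^k}},\qquad \|H\|_{C^k}=\sup_{\zeta\in[0,1]\times\mathbb T^2}\big(\|H(\zeta)\|+\|\nabla^kH(\zeta)\|\big),$$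 and let $$\mathcal L=\{H\in C^\infty([0,1]\times\mathbb T^2,\mathcal E):\ H(0,\cdot)=H_0,\ H(1,\cdot)=H_1\}$$ carry the induced topology. For $H\in\mathcal L$, say that $\lambda_n(H)$ and $\lambda_{n+1}(H)$ cross at $\zeta_0\in[0,1]\times\mathbb T^2$ if $\lambda_n(H(\zeta_0))=\lambda_{n+1}(H(\zeta_0))$, and that this crossing is conical if the eigenvalue $\lambda_n(H(\zeta_0))$ of $H(\zeta_0)$ has multiplicity precisely two and there exist $a_0\in\mathbb R^3$ and an invertible $S_0\in M_3(\mathbb R)$ such that, as $\varepsilon\to0$ in $\mathbb R^3$ with $\zeta_0+\varepsilon\in[0,1]\times\mathbb T^2$, $$\lambda_n(H(\zeta_0+\varepsilon))=\lambda_n(H(\zeta_0))+\langle a_0,\varepsilon\rangle-\|S_0\varepsilon\|+o(\varepsilon),$$ $$\lambda_{n+1}(H(\zeta_0+\varepsilon))=\lambda_n(H(\zeta_0))+\langle a_0,\varepsilon\rangle+\|S_0\varepsilon\|+o(\varepsilon).$$ Then $$\mathbb L=\{H\in\mathcal L:\ \text{all crossings of }\lambda_n(H)\text{ and }\lambda_{n+1}(H)\text{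 are conical}\}$$ is a dense open subset of $\mathcal L$. -/

import Mathlib

open Filter Topology Asymptotics
open scoped ContDiff

/- Hermitian matrices carry the norm `‖A‖ = Tr(A²)^{1/2}`, the Frobenius norm. -/
attribute [local instance] Matrix.frobeniusNormedAddCommGroup Matrix.frobeniusNormedSpace

namespace ConicalCrossings

/-! ### Hermitian matrices and their eigenvalues -/

/-- The space of `N × N` Hermitian matrices. -/
abbrev Herm (N : ℕ) : Type := {A : Matrix (Fin N) (Fin N) ℂ // A.IsHermitian}

/-- The `j`-th eigenvalue `λ_j(A)`, `1 ≤ j ≤ N`, of a Hermitian matrix, where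
`λ_1(A) ≤ … ≤ λ_N(A)` are repeated according to multiplicity (Mathlib's `eigenvalues₀` lists
them in decreasing order). For `j` outside `[1, N]` the value is the irrelevant default `0`. -/
noncomputable def eigval {N : ℕ} (A : Herm N) (j : ℕ) : ℝ :=
  if h : 1 ≤ j ∧ j ≤ N then
    A.2.eigenvalues₀ ⟨N - j, by rw [Fintype.card_fin]; omega⟩
  else 0

/-! ### The torus and smooth families of Hermitian matrices -/

/-- The torus `𝕋² = (ℝ / 2πℤ)²`. -/
abbrev Torus : Type := AddCircle (2 * Real.pi) × AddCircle (2 * Real.pi)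

/-- The parameter space `[0,1] × 𝕋²`. -/
abbrev Cylinder : Type := Set.Icc (0 : ℝ) 1 × Torus

/-- `ℝ³` with its Euclidean structure. -/
abbrev E3 : Type := EuclideanSpace ℝ (Fin 3)

/-- The universal cover `[0,1] × ℝ²` of `[0,1] × 𝕋²`, as a subset of `ℝ³`. -/
def slab : Set E3 := {x | x 0 ∈ Set.Icc (0 : ℝ) 1}

/-- A function on `[0,1] × 𝕋²`, read on the universal cover; only the values on `slab` matter. -/
noncomputable def lift {α : Type*} (f : Cylinder → α) (x : E3) : α :=
  f (Set.projIcc 0 1 zero_le_one (x 0), ((x 1 : AddCircle (2 * Real.pi)),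
    (x 2 : AddCircle (2 * Real.pi))))

/-- The space `C^∞(𝕋², Herm N)`. -/
structure TorusFamily (N : ℕ) where
  toFun : Torus → Herm N
  smooth : ContDiff ℝ ∞ (fun x : EuclideanSpace ℝ (Fin 2) =>
    (toFun ((x 0 : AddCircle (2 * Real.pi)), (x 1 : AddCircle (2 * Real.pi))) :
      Matrix (Fin N) (Fin N) ℂ))

/-- The space `C^∞([0,1] × 𝕋², Herm N)`: smooth functions in the interior whose derivatives of all
orders extend continuously to the boundary. -/
structure CylinderFamily (N : ℕ) where
  toFun : Cylinder → Herm N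
  smooth : ContDiffOn ℝ ∞ (fun x => (lift toFun x).1) slab

instance (N : ℕ) : CoeFun (TorusFamily N) (fun _ => Torus → Herm N) := ⟨TorusFamily.toFun⟩

instance (N : ℕ) : CoeFun (CylinderFamily N) (fun _ => Cylinder → Herm N) :=
  ⟨CylinderFamily.toFun⟩

/-! ### The `C^∞` topology -/

/-- The matrix-valued function on `slab` given by a family on `[0,1] × 𝕋²`. -/
noncomputable def CylinderFamily.mat {N : ℕ} (H : CylinderFamily N) (x : E3) :
    Matrix (Fin N) (Fin N) ℂ := (lift H.toFun x).1

/-- The norm `‖F‖_{C^k} = sup (‖F(x)‖ + ‖∇^k F(x)‖)` over `[0,1] × ℝ²`. -/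
noncomputable def ckNorm {N : ℕ} (k : ℕ) (F : E3 → Matrix (Fin N) (Fin N) ℂ) : ℝ :=
  ⨆ x : slab, (‖F x‖ + ‖iteratedFDerivWithin ℝ k F slab x‖)

/-- The distance `d(H, H') = ∑_k 2^{-k} ‖H - H'‖_{C^k} / (1 + ‖H - H'‖_{C^k})`. -/
noncomputable def cinftyDist {N : ℕ} (H H' : CylinderFamily N) : ℝ :=
  ∑' k : ℕ, (2 : ℝ)⁻¹ ^ k * (ckNorm k (fun x => H.mat x - H'.mat x) /
    (1 + ckNorm k (fun x => H.mat x - H'.mat x)))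

theorem slab_eq_preimage : slab = (EuclideanSpace.proj (0 : Fin 3) : E3 →L[ℝ] ℝ) ⁻¹'
    Set.Icc (0 : ℝ) 1 := rfl

theorem convex_slab : Convex ℝ slab := by
  rw [slab_eq_preimage]
  exact (convex_Icc (0 : ℝ) 1).linear_preimage
    (EuclideanSpace.proj (0 : Fin 3) : E3 →L[ℝ] ℝ).toLinearMap

theorem uniqueDiffOn_slab : UniqueDiffOn ℝ slab := by
  apply uniqueDiffOn_convex convex_slab
  refine ⟨!₂[1 / 2, 0, 0], ?_⟩
  have ho : IsOpen ((EuclideanSpace.proj (0 : Fin 3) : E3 →L[ℝ] ℝ) ⁻¹' Set.Ioo (0 : ℝ) 1) :=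
    isOpen_Ioo.preimage (EuclideanSpace.proj (0 : Fin 3) : E3 →L[ℝ] ℝ).continuous
  refine interior_maximal ?_ ho ?_
  · rw [slab_eq_preimage]
    exact Set.preimage_mono Set.Ioo_subset_Icc_self
  · change (1 / 2 : ℝ) ∈ Set.Ioo (0 : ℝ) 1
    norm_num

/-- Every point of the slab is, up to a period, in a fixed compact part of it. -/
theorem exists_period (x : E3) (hx : x ∈ slab) : ∃ a : E3, a 0 = 0 ∧
    (∃ m : ℤ, a 1 = m • (2 * Real.pi)) ∧ (∃ m : ℤ, a 2 = m • (2 * Real.pi)) ∧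
    a + x ∈ slab ∧ ‖a + x‖ ≤ 1 + 4 * Real.pi := by
  have hp : 0 < 2 * Real.pi := Real.two_pi_pos
  obtain ⟨m, hm, -⟩ := existsUnique_add_zsmul_mem_Ico hp (x 1) 0
  obtain ⟨l, hl, -⟩ := existsUnique_add_zsmul_mem_Ico hp (x 2) 0
  refine ⟨!₂[0, m • (2 * Real.pi), l • (2 * Real.pi)], by simp, ⟨m, by simp⟩, ⟨l, by simp⟩, ?_, ?_⟩
  · simpa [slab] using hx
  · have hx' : x 0 ∈ Set.Icc (0 : ℝ) 1 := hx
    rw [EuclideanSpace.norm_eq]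
    apply Real.sqrt_le_iff.2
    refine ⟨by positivity, ?_⟩
    simp only [Fin.sum_univ_three, Real.norm_eq_abs, sq_abs]
    simp only [PiLp.add_apply]
    simp only [Set.mem_Ico, Set.mem_Icc, zero_add] at hm hl hx'
    simp only [Matrix.cons_val_zero, Matrix.cons_val_one, Matrix.cons_val]
    rw [add_comm (x 1)] at hm
    rw [add_comm (x 2)] at hl
    have h0 : (0 + x 0) ^ 2 ≤ 1 := by nlinarith [hx'.1, hx'.2]
    have h1 := pow_le_pow_left₀ hm.1 hm.2.le 2
    have h2 := pow_le_pow_left₀ hl.1 hl.2.le 2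
    nlinarith [Real.pi_pos]

open scoped Pointwise in
theorem vadd_slab (a : E3) (ha : a 0 = 0) : a +ᵥ slab = slab := by
  ext x
  simp [Set.mem_vadd_set_iff_neg_vadd_mem, slab, ha]

theorem lift_add {α : Type*} (f : Cylinder → α) (a x : E3) (h0 : a 0 = 0)
    (h1 : ∃ m : ℤ, a 1 = m • (2 * Real.pi)) (h2 : ∃ m : ℤ, a 2 = m • (2 * Real.pi)) :
    lift f (a + x) = lift f x := by
  obtain ⟨m, h1⟩ := h1
  obtain ⟨l, h2⟩ := h2
  have e1 : ((m • (2 * Real.pi) : ℝ) : AddCircle (2 * Real.pi)) = 0 := by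
    rw [AddCircle.coe_zsmul, AddCircle.coe_period, smul_zero]
  have e2 : ((l • (2 * Real.pi) : ℝ) : AddCircle (2 * Real.pi)) = 0 := by
    rw [AddCircle.coe_zsmul, AddCircle.coe_period, smul_zero]
  simp only [lift, PiLp.add_apply, h0, h1, h2, zero_add, AddCircle.coe_add, e1, e2]

theorem smooth_sub {N : ℕ} (H H' : CylinderFamily N) :
    ContDiffOn ℝ ∞ (fun x => H.mat x - H'.mat x) slab := H.smooth.sub H'.smooth

/-- The supremum that defines `‖H - H'‖_{C^k}` is finite. -/
theorem bddAbove_ck {N : ℕ} (k : ℕ) (H H' : CylinderFamily N) :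
    BddAbove (Set.range fun x : slab => ‖H.mat x - H'.mat x‖ +
      ‖iteratedFDerivWithin ℝ k (fun x => H.mat x - H'.mat x) slab x‖) := by
  set F : E3 → Matrix (Fin N) (Fin N) ℂ := fun x => H.mat x - H'.mat x with hF
  have hs : ContDiffOn ℝ ∞ F slab := smooth_sub H H'
  have hc : ContinuousOn (fun x => ‖F x‖ + ‖iteratedFDerivWithin ℝ k F slab x‖) slab :=
    hs.continuousOn.norm.add
      (hs.continuousOn_iteratedFDerivWithin (by exact_mod_cast le_top) uniqueDiffOn_slab).norm
  have hclosed : IsClosed slab := by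
    rw [slab_eq_preimage]
    exact isClosed_Icc.preimage (EuclideanSpace.proj (0 : Fin 3) : E3 →L[ℝ] ℝ).continuous
  have hK : IsCompact (slab ∩ Metric.closedBall (0 : E3) (1 + 4 * Real.pi)) :=
    (isCompact_closedBall _ _).inter_left hclosed
  obtain ⟨C, hC⟩ := (hK.image_of_continuousOn (hc.mono Set.inter_subset_left)).bddAbove
  refine ⟨C, ?_⟩
  rintro _ ⟨⟨x, hx⟩, rfl⟩
  obtain ⟨a, h0, h1, h2, h3, h4⟩ := exists_period x hx
  have hper : (fun z => F (a + z)) = F := by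
    funext z
    simp only [hF, CylinderFamily.mat, lift_add _ a z h0 h1 h2]
  have hd := iteratedFDerivWithin_comp_add_left (𝕜 := ℝ) (f := F) (s := slab) k a x
  rw [hper, vadd_slab a h0] at hd
  have hv : F x = F (a + x) := (congrFun hper x).symm
  have : ‖F (a + x)‖ + ‖iteratedFDerivWithin ℝ k F slab (a + x)‖ ≤ C :=
    hC ⟨a + x, ⟨h3, by simpa using h4⟩, rfl⟩
  change ‖F x‖ + ‖iteratedFDerivWithin ℝ k F slab x‖ ≤ C
  rw [hd, hv]
  exact this

theorem ckNorm_nonneg {N : ℕ} (k : ℕ) (F : E3 → Matrix (Fin N) (Fin N) ℂ) : 0 ≤ ckNorm k F :=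
  Real.iSup_nonneg fun _ => by positivity

theorem le_ckNorm {N : ℕ} (k : ℕ) (H H' : CylinderFamily N) (x : E3) (hx : x ∈ slab) :
    ‖H.mat x - H'.mat x‖ + ‖iteratedFDerivWithin ℝ k (fun x => H.mat x - H'.mat x) slab x‖ ≤
      ckNorm k (fun x => H.mat x - H'.mat x) :=
  le_ciSup (bddAbove_ck k H H') (⟨x, hx⟩ : slab)

theorem ckNorm_triangle {N : ℕ} (k : ℕ) (H₁ H₂ H₃ : CylinderFamily N) :
    ckNorm k (fun x => H₁.mat x - H₃.mat x) ≤
      ckNorm k (fun x => H₁.mat x - H₂.mat x) + ckNorm k (fun x => H₂.mat x - H₃.mat x) := by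
  have : Nonempty slab := ⟨⟨0, by simp [slab]⟩⟩
  refine ciSup_le fun ⟨x, hx⟩ => ?_
  have h12 := le_ckNorm k H₁ H₂ x hx
  have h23 := le_ckNorm k H₂ H₃ x hx
  have e : (fun x => H₁.mat x - H₃.mat x) =
      (fun x => H₁.mat x - H₂.mat x) + (fun x => H₂.mat x - H₃.mat x) := by
    funext y
    simp
  have hd : iteratedFDerivWithin ℝ k (fun x => H₁.mat x - H₃.mat x) slab x =
      iteratedFDerivWithin ℝ k (fun x => H₁.mat x - H₂.mat x) slab x +
      iteratedFDerivWithin ℝ k (fun x => H₂.mat x - H₃.mat x) slab x := by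
    rw [e]
    exact iteratedFDerivWithin_add_apply
      (((smooth_sub H₁ H₂).of_le (by exact_mod_cast le_top)) x hx)
      (((smooth_sub H₂ H₃).of_le (by exact_mod_cast le_top)) x hx) uniqueDiffOn_slab hx
  have hn := norm_add_le (iteratedFDerivWithin ℝ k (fun x => H₁.mat x - H₂.mat x) slab x)
    (iteratedFDerivWithin ℝ k (fun x => H₂.mat x - H₃.mat x) slab x)
  have hm := norm_add_le (H₁.mat x - H₂.mat x) (H₂.mat x - H₃.mat x)
  rw [sub_add_sub_cancel] at hm
  change ‖H₁.mat x - H₃.mat x‖ + _ ≤ _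
  rw [hd]
  linarith

theorem div_one_add_nonneg {t : ℝ} (ht : 0 ≤ t) : 0 ≤ t / (1 + t) := by positivity

theorem div_one_add_le_one {t : ℝ} (ht : 0 ≤ t) : t / (1 + t) ≤ 1 := by
  rw [div_le_one (by linarith)]
  linarith

theorem div_one_add_subadd {r s t : ℝ} (hr : 0 ≤ r) (hs : 0 ≤ s) (ht : 0 ≤ t) (h : r ≤ s + t) :
    r / (1 + r) ≤ s / (1 + s) + t / (1 + t) := by
  have h1 : r / (1 + r) ≤ (s + t) / (1 + (s + t)) := by
    rw [div_le_div_iff₀ (by linarith) (by linarith)]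
    nlinarith
  have h2 : s / (1 + (s + t)) ≤ s / (1 + s) := by
    apply div_le_div_of_nonneg_left hs <;> linarith
  have h3 : t / (1 + (s + t)) ≤ t / (1 + t) := by
    apply div_le_div_of_nonneg_left ht <;> linarith
  rw [add_div] at h1
  linarith

theorem summable_cinftyDist {N : ℕ} (H H' : CylinderFamily N) :
    Summable fun k : ℕ => (2 : ℝ)⁻¹ ^ k * (ckNorm k (fun x => H.mat x - H'.mat x) /
      (1 + ckNorm k (fun x => H.mat x - H'.mat x))) := by
  refine Summable.of_nonneg_of_le (fun k => ?_) (fun k => ?_)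
    (summable_geometric_of_lt_one (r := (2 : ℝ)⁻¹) (by norm_num) (by norm_num))
  · exact mul_nonneg (by positivity) (div_one_add_nonneg (ckNorm_nonneg _ _))
  · exact mul_le_of_le_one_right (by positivity) (div_one_add_le_one (ckNorm_nonneg _ _))

theorem eq_of_mat_eq {N : ℕ} {H H' : CylinderFamily N} (h : ∀ x ∈ slab, H.mat x = H'.mat x) :
    H = H' := by
  obtain ⟨f, hf⟩ := H
  obtain ⟨g, hg⟩ := H'
  congr 1
  funext ζ
  obtain ⟨⟨s, hs⟩, ξ, η⟩ := ζ
  induction ξ using QuotientAddGroup.induction_on with | _ ξ =>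
  induction η using QuotientAddGroup.induction_on with | _ η =>
  have := h !₂[s, ξ, η] (by simpa [slab] using hs)
  apply Subtype.ext
  simpa [CylinderFamily.mat, lift, Set.projIcc_of_mem zero_le_one hs] using this

/-- The metric of `C^∞([0,1] × 𝕋², Herm N)`; its topology is the one of uniform convergence of all
derivatives. -/
noncomputable instance (N : ℕ) : MetricSpace (CylinderFamily N) where
  dist := cinftyDist
  dist_self H := by
    have h0 : (fun x : E3 => H.mat x - H.mat x) = fun _ => 0 := by
      funext x
      simp
    have hz : (fun _ : E3 => (0 : Matrix (Fin N) (Fin N) ℂ)) = 0 := rfl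
    simp [cinftyDist, ckNorm, hz]
  dist_comm H H' := by
    have h (k : ℕ) : ckNorm k (fun x => H.mat x - H'.mat x) =
        ckNorm k (fun x => H'.mat x - H.mat x) := by
      have e : (fun x => H.mat x - H'.mat x) = -(fun x => H'.mat x - H.mat x) := by
        funext y
        simp
      unfold ckNorm
      refine iSup_congr fun x => ?_
      rw [e, iteratedFDerivWithin_neg_apply uniqueDiffOn_slab x.2, norm_neg, Pi.neg_apply, norm_neg]
    simp only [cinftyDist, h]
  dist_triangle H₁ H₂ H₃ := by
    rw [cinftyDist, cinftyDist, cinftyDist,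
      ← (summable_cinftyDist H₁ H₂).tsum_add (summable_cinftyDist H₂ H₃)]
    refine (summable_cinftyDist H₁ H₃).tsum_le_tsum (fun k => ?_)
      ((summable_cinftyDist H₁ H₂).add (summable_cinftyDist H₂ H₃))
    rw [← mul_add]
    exact mul_le_mul_of_nonneg_left (div_one_add_subadd (ckNorm_nonneg _ _) (ckNorm_nonneg _ _)
      (ckNorm_nonneg _ _) (ckNorm_triangle k H₁ H₂ H₃)) (by positivity)
  eq_of_dist_eq_zero {H H'} h := by
    have hn : ∀ k : ℕ, 0 ≤ (2 : ℝ)⁻¹ ^ k * (ckNorm k (fun x => H.mat x - H'.mat x) /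
        (1 + ckNorm k (fun x => H.mat x - H'.mat x))) := fun k =>
      mul_nonneg (by positivity) (div_one_add_nonneg (ckNorm_nonneg _ _))
    have h1 := (summable_cinftyDist H H').le_tsum 0 (fun k _ => hn k)
    have h2 : cinftyDist H H' = 0 := h
    rw [← cinftyDist, h2, pow_zero, one_mul] at h1
    have hc := ckNorm_nonneg 0 (fun x => H.mat x - H'.mat x)
    have h3 : ckNorm 0 (fun x => H.mat x - H'.mat x) ≤ 0 := by
      rw [div_le_iff₀ (by linarith), zero_mul] at h1
      exact h1
    refine eq_of_mat_eq fun x hx => ?_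
    have h4 := le_ckNorm 0 H H' x hx
    have h5 := norm_nonneg (iteratedFDerivWithin ℝ 0 (fun x => H.mat x - H'.mat x) slab x)
    have h6 := norm_nonneg (H.mat x - H'.mat x)
    exact sub_eq_zero.1 (norm_eq_zero.1 (by linarith))

/-! ### Homotopies and their crossings -/

/-- The space of smooth homotopies from `H₀` to `H₁`, with the topology induced by
`C^∞([0,1] × 𝕋², Herm N)`. -/
def homotopies {N : ℕ} (H₀ H₁ : TorusFamily N) : Set (CylinderFamily N) :=
  {H | (∀ ξ : Torus, H (⟨0, by simp⟩, ξ) = H₀ ξ) ∧ (∀ ξ : Torus, H (⟨1, by simp⟩, ξ) = H₁ ξ)}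

/-- The eigenvalues `λ_n(H)` and `λ_{n+1}(H)` cross at `ζ₀`. -/
def Crosses {N : ℕ} (n : ℕ) (H : CylinderFamily N) (ζ₀ : Cylinder) : Prop :=
  eigval (H ζ₀) n = eigval (H ζ₀) (n + 1)

/-- The point `ζ₀ + ε` of `[0,1] × 𝕋²`, for `ζ₀ ∈ [0,1] × 𝕋²` and `ε ∈ ℝ³` in `admissible ζ₀`. -/
noncomputable def shift (ζ₀ : Cylinder) (ε : E3) : Cylinder :=
  (Set.projIcc 0 1 zero_le_one ((ζ₀.1 : ℝ) + ε 0),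
    (ζ₀.2.1 + (ε 1 : AddCircle (2 * Real.pi)), ζ₀.2.2 + (ε 2 : AddCircle (2 * Real.pi))))

/-- The `ε ∈ ℝ³` for which `ζ₀ + ε` is in `[0,1] × 𝕋²`. -/
def admissible (ζ₀ : Cylinder) : Set E3 := {ε | (ζ₀.1 : ℝ) + ε 0 ∈ Set.Icc (0 : ℝ) 1}

/-- The eigenvalues `λ_n(H)` and `λ_{n+1}(H)` cross conically at `ζ₀`: they cross there, their
common value has multiplicity precisely two, and near `ζ₀` their graphs are, to first order, the
two halves of a tilted cone with invertible `S₀`. -/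
def CrossesConically {N : ℕ} (n : ℕ) (H : CylinderFamily N) (ζ₀ : Cylinder) : Prop :=
  Crosses n H ζ₀ ∧
  (H ζ₀ : Matrix (Fin N) (Fin N) ℂ).charpoly.rootMultiplicity ((eigval (H ζ₀) n : ℝ) : ℂ) = 2 ∧
  ∃ (a₀ : E3) (S₀ : Matrix (Fin 3) (Fin 3) ℝ), IsUnit S₀ ∧
    (fun ε : E3 => eigval (H (shift ζ₀ ε)) n -
        (eigval (H ζ₀) n + inner ℝ a₀ ε - ‖Matrix.toEuclideanLin S₀ ε‖))
      =o[𝓝[admissible ζ₀] 0] (fun ε : E3 => ε) ∧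
    (fun ε : E3 => eigval (H (shift ζ₀ ε)) (n + 1) -
        (eigval (H ζ₀) n + inner ℝ a₀ ε + ‖Matrix.toEuclideanLin S₀ ε‖))
      =o[𝓝[admissible ζ₀] 0] (fun ε : E3 => ε)

/-- The homotopies from `H₀` to `H₁` all of whose crossings of `λ_n` and `λ_{n+1}` are conical. -/
def conicalHomotopies {N : ℕ} (n : ℕ) (H₀ H₁ : TorusFamily N) : Set (homotopies H₀ H₁) :=
  {H | ∀ ζ₀ : Cylinder, Crosses n H.1 ζ₀ → CrossesConically n H.1 ζ₀}

end ConicalCrossings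

namespace ConicalCrossings

open Matrix

/-! ### Matrices acting on Euclidean space and their quadratic forms -/

section MatrixAction

variable {l m k : Type*} [Fintype m] [Fintype k] [DecidableEq k]

/-! Hermitian matrices with a double eigenvalue form a set of codimension three, and the parameter
space has dimension three, so generically a family meets this set transversally; transversality at a
double eigenvalue is conicality.

Let the columns of Q be an orthonormal basis of the eigenspace of a double eigenvalue c of A. By
`exists_abs_eigval_add_sub_le` the two eigenvalues of A + B near c are c plus half the trace of
Q*BQ, minus or plus the norm of its traceless part (a vector of ℝ³ in Pauli coordinates), up to
O(‖B‖²). So a crossing in the interior is conical exactly when the eigenvalue is not triple and the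
linear map from ε to the Pauli vector of Q*(∂_ε H)Q is invertible. `Degenerate` is the failure of
this. Crossings are always interior, because both ends have a gap.

Openness: `Degenerate` depends only on the value and the first derivatives, and asks for a frame and
a unit direction, taken from compact sets, that solve closed equations. Hence the degenerate jets
form a closed set (`isClosed_degenerateJets`). Jets are jointly continuous in the family and the
point, and a compact part of the slab covers the cylinder, so avoiding this set is an open
condition.

Density: add a small constant Hermitian S, cut off near the ends, where the gap excludes crossings
anyway. Matrices with an at least double eigenvalue are the values F(c, X, C) of finitely many
charts: c is the eigenvalue, X a plane of eigenvectors written as a graph, C the remaining block.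
These are N² - 3 real parameters. With the point x they become N², and Φ(c, X, C, x) = F(c, X, C) -
H(x) takes the value S when H(x) + S = F(c, X, C). Both kinds of degeneracy force dΦ to have a
kernel, so by Sard's theorem in equal dimensions almost every S leaves no degenerate crossing
(`exists_norm_lt_not_degenerate`). -/

theorem norm_toEuclideanLin_le (A : Matrix m k ℂ) (x : EuclideanSpace ℂ k) :
    ‖toEuclideanLin A x‖ ≤ ‖A‖ * ‖x‖ := by
  have h := frobenius_norm_mul A (replicateCol Unit x.ofLp)
  have e : A * replicateCol Unit x.ofLp = replicateCol Unit (A *ᵥ x.ofLp) := by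
    ext i j; rfl
  rw [e, frobenius_norm_replicateCol, frobenius_norm_replicateCol] at h
  exact h

variable [DecidableEq m]

theorem toEuclideanLin_mul_apply (A : Matrix l m ℂ) (B : Matrix m k ℂ) (x : EuclideanSpace ℂ k) :
    toEuclideanLin (A * B) x = toEuclideanLin A (toEuclideanLin B x) := by
  simp [toLpLin_apply, mulVec_mulVec]

theorem inner_toEuclideanLin_left (A : Matrix m k ℂ) (x : EuclideanSpace ℂ k)
    (y : EuclideanSpace ℂ m) :
    inner ℂ (toEuclideanLin A x) y = inner ℂ x (toEuclideanLin Aᴴ y) := by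
  rw [toEuclideanLin_conjTranspose_eq_adjoint, LinearMap.adjoint_inner_right]

/-- The real quadratic form `⟨x, A x⟩`. -/
noncomputable def quadForm (A : Matrix m m ℂ) (x : EuclideanSpace ℂ m) : ℝ :=
  (inner ℂ x (toEuclideanLin A x)).re

theorem quadForm_add (A B : Matrix m m ℂ) (x : EuclideanSpace ℂ m) :
    quadForm (A + B) x = quadForm A x + quadForm B x := by
  simp [quadForm]

theorem quadForm_neg (A : Matrix m m ℂ) (x : EuclideanSpace ℂ m) :
    quadForm (-A) x = -quadForm A x := by
  simp [quadForm]

theorem abs_inner_toEuclideanLin_le (A : Matrix m m ℂ) (x y : EuclideanSpace ℂ m) :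
    |(inner ℂ x (toEuclideanLin A y)).re| ≤ ‖A‖ * ‖x‖ * ‖y‖ := by
  calc |(inner ℂ x (toEuclideanLin A y)).re| ≤ ‖inner ℂ x (toEuclideanLin A y)‖ :=
        Complex.abs_re_le_norm _
    _ ≤ ‖x‖ * ‖toEuclideanLin A y‖ := norm_inner_le_norm _ _
    _ ≤ ‖x‖ * (‖A‖ * ‖y‖) := by gcongr; exact norm_toEuclideanLin_le A y
    _ = ‖A‖ * ‖x‖ * ‖y‖ := by ring

theorem abs_quadForm_le (A : Matrix m m ℂ) (x : EuclideanSpace ℂ m) :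
    |quadForm A x| ≤ ‖A‖ * ‖x‖ ^ 2 := by
  rw [sq, ← mul_assoc]
  exact abs_inner_toEuclideanLin_le A x x

theorem quadForm_add_vec {A : Matrix m m ℂ} (hA : A.IsHermitian) (x y : EuclideanSpace ℂ m) :
    quadForm A (x + y) = quadForm A x + quadForm A y + 2 * (inner ℂ x (toEuclideanLin A y)).re := by
  have h : (inner ℂ y (toEuclideanLin A x)).re = (inner ℂ x (toEuclideanLin A y)).re := by
    have := inner_toEuclideanLin_left A x y
    rw [hA.eq] at this
    rw [← this, ← inner_conj_symm, Complex.conj_re]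
  simp only [quadForm, map_add, inner_add_left, inner_add_right, Complex.add_re, h]
  ring

end MatrixAction

/-! ### Min-max principle and Weyl's inequality -/

section Eigenvalues

variable {N : ℕ}

theorem eigval_mono (A : Herm N) {i j : ℕ} (hi : 1 ≤ i) (hij : i ≤ j) (hj : j ≤ N) :
    eigval A i ≤ eigval A j := by
  rw [eigval, eigval, dif_pos ⟨hi, hij.trans hj⟩, dif_pos ⟨hi.trans hij, hj⟩]
  apply A.2.eigenvalues₀_antitone
  simp only [Fin.mk_le_mk]
  omega

/-- The permutation that lists Mathlib's eigenvalues in increasing order. -/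
noncomputable def sortPerm (N : ℕ) : Fin N ≃ Fin N :=
  (Fin.revPerm.trans (finCongr (Fintype.card_fin N).symm)).trans
    (Fintype.equivOfCardEq (Fintype.card_fin _))

theorem eigenvalues_sortPerm (A : Herm N) (i : Fin N) :
    A.2.eigenvalues (sortPerm N i) = eigval A (i + 1) := by
  have hi := i.2
  rw [eigval, dif_pos ⟨by omega, by omega⟩, Matrix.IsHermitian.eigenvalues]
  congr 1
  simp only [sortPerm, Equiv.trans_apply, Equiv.symm_apply_apply]
  ext
  simp

/-- An orthonormal basis of eigenvectors, in increasing order of the eigenvalues. -/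
noncomputable def eigBasis (A : Herm N) : OrthonormalBasis (Fin N) ℂ (EuclideanSpace ℂ (Fin N)) :=
  A.2.eigenvectorBasis.reindex (sortPerm N).symm

theorem toEuclideanLin_eigBasis (A : Herm N) (i : Fin N) :
    toEuclideanLin A.1 (eigBasis A i) = (eigval A (i + 1) : ℂ) • eigBasis A i := by
  have h := A.2.mulVec_eigenvectorBasis (sortPerm N i)
  rw [eigenvalues_sortPerm] at h
  rw [eigBasis, OrthonormalBasis.reindex_apply, Equiv.symm_symm]
  ext j
  simpa using congrFun h j

theorem inner_eigBasis_toEuclideanLin (A : Herm N) (i : Fin N) (x : EuclideanSpace ℂ (Fin N)) :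
    inner ℂ (eigBasis A i) (toEuclideanLin A.1 x) =
      (eigval A (i + 1) : ℂ) * inner ℂ (eigBasis A i) x := by
  have h := inner_toEuclideanLin_left A.1 (eigBasis A i) x
  rw [A.2.eq, toEuclideanLin_eigBasis, inner_smul_left] at h
  rw [← h, Complex.conj_ofReal]

theorem quadForm_eq_sum (A : Herm N) (x : EuclideanSpace ℂ (Fin N)) :
    quadForm A.1 x = ∑ i : Fin N, eigval A (i + 1) * ‖inner ℂ (eigBasis A i) x‖ ^ 2 := by
  rw [quadForm, ← (eigBasis A).sum_inner_mul_inner, Complex.re_sum]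
  refine Finset.sum_congr rfl fun i _ => ?_
  rw [inner_eigBasis_toEuclideanLin, mul_left_comm, ← inner_conj_symm x, Complex.re_ofReal_mul,
    Complex.conj_mul', ← Complex.ofReal_pow, Complex.ofReal_re]

theorem quadForm_le_of_inner_eq_zero (A : Herm N) {c : ℝ} (x : EuclideanSpace ℂ (Fin N))
    (h : ∀ i : Fin N, c < eigval A (i + 1) → inner ℂ (eigBasis A i) x = 0) :
    quadForm A.1 x ≤ c * ‖x‖ ^ 2 := by
  rw [quadForm_eq_sum, ← (eigBasis A).sum_sq_norm_inner_right x, Finset.mul_sum]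
  refine Finset.sum_le_sum fun i _ => ?_
  by_cases hi : c < eigval A (i + 1)
  · simp [h i hi]
  · exact mul_le_mul_of_nonneg_right (not_lt.1 hi) (by positivity)

theorem le_quadForm_of_inner_eq_zero (A : Herm N) {c : ℝ} (x : EuclideanSpace ℂ (Fin N))
    (h : ∀ i : Fin N, eigval A (i + 1) < c → inner ℂ (eigBasis A i) x = 0) :
    c * ‖x‖ ^ 2 ≤ quadForm A.1 x := by
  rw [quadForm_eq_sum, ← (eigBasis A).sum_sq_norm_inner_right x, Finset.mul_sum]
  refine Finset.sum_le_sum fun i _ => ?_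
  by_cases hi : eigval A (i + 1) < c
  · simp [h i hi]
  · exact mul_le_mul_of_nonneg_right (not_lt.1 hi) (by positivity)

/-- The upper bound in the min-max principle. -/
theorem eigval_le_of_quadForm_le (A : Herm N) {j : ℕ} (h1 : 1 ≤ j) (hj : j ≤ N) {c : ℝ}
    (V : Submodule ℂ (EuclideanSpace ℂ (Fin N))) (hV : j ≤ Module.finrank ℂ V)
    (h : ∀ x ∈ V, quadForm A.1 x ≤ c * ‖x‖ ^ 2) : eigval A j ≤ c := by
  -- Only j - 1 linear conditions are imposed on V, so a nonzero vector of V is orthogonal to the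
  -- first j - 1 eigenvectors; there the form is at least λ_j.
  let f : V →ₗ[ℂ] (Fin (j - 1) → ℂ) := LinearMap.pi fun i =>
    (innerₛₗ ℂ (eigBasis A ⟨i, by omega⟩)).comp V.subtype
  have hker : LinearMap.ker f ≠ ⊥ := by
    apply LinearMap.ker_ne_bot_of_finrank_lt
    rw [Module.finrank_fin_fun]
    omega
  obtain ⟨⟨x, hxV⟩, hx, hx0⟩ := Submodule.exists_mem_ne_zero_of_ne_bot hker
  have hx0 : x ≠ 0 := fun h => hx0 (Subtype.ext h)
  have h2 := le_quadForm_of_inner_eq_zero A (c := eigval A j) x fun i hi => by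
    have hij : (i : ℕ) < j - 1 := by
      by_contra hcon
      exact absurd (eigval_mono A h1 (by omega : j ≤ i + 1) (by omega)) (not_le.2 hi)
    exact congrFun (LinearMap.mem_ker.1 hx) ⟨i, hij⟩
  have h3 := h2.trans (h x hxV)
  exact le_of_mul_le_mul_right h3 (by positivity)

/-- The span of the first `p` eigenvectors. -/
noncomputable def lowerSpan (A : Herm N) (p : ℕ) : Submodule ℂ (EuclideanSpace ℂ (Fin N)) :=
  Submodule.span ℂ (Set.range fun i : {i : Fin N // (i : ℕ) < p} => eigBasis A i)

theorem finrank_lowerSpan (A : Herm N) {p : ℕ} (hp : p ≤ N) :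
    Module.finrank ℂ (lowerSpan A p) = p := by
  rw [lowerSpan, finrank_span_eq_card]
  · rw [Fintype.card_subtype]
    have : (Finset.univ.filter fun i : Fin N => (i : ℕ) < p) =
        Finset.univ.map (Fin.castLEEmb hp) := by
      ext i
      simp only [Finset.mem_filter, Finset.mem_univ, true_and, Finset.mem_map]
      exact ⟨fun h => ⟨⟨i, h⟩, rfl⟩, by rintro ⟨k, rfl⟩; exact k.2⟩
    rw [this, Finset.card_map, Finset.card_univ, Fintype.card_fin]
  · exact (eigBasis A).orthonormal.linearIndependent.comp _ Subtype.val_injective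

theorem inner_eigBasis_of_mem_lowerSpan (A : Herm N) {p : ℕ} {x : EuclideanSpace ℂ (Fin N)}
    (hx : x ∈ lowerSpan A p) {i : Fin N} (hi : p ≤ i) : inner ℂ (eigBasis A i) x = 0 := by
  induction hx using Submodule.span_induction with
  | mem x hx =>
    obtain ⟨k, rfl⟩ := hx
    exact (eigBasis A).orthonormal.2 fun h => by have := k.2; simp only [← h] at this; omega
  | zero => simp
  | add x y _ _ hx hy => rw [inner_add_right, hx, hy, add_zero]
  | smul a x _ hx => rw [inner_smul_right, hx, mul_zero]

theorem quadForm_le_of_mem_lowerSpan (A : Herm N) {p : ℕ} {c : ℝ}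
    (hc : ∀ j, 1 ≤ j → j ≤ p → j ≤ N → eigval A j ≤ c)
    {x : EuclideanSpace ℂ (Fin N)} (hx : x ∈ lowerSpan A p) : quadForm A.1 x ≤ c * ‖x‖ ^ 2 :=
  quadForm_le_of_inner_eq_zero A x fun i hi => inner_eigBasis_of_mem_lowerSpan A hx <| by
    by_contra hcon
    exact absurd (hc (i + 1) (by omega) (by omega) (by omega)) (not_le.2 hi)

theorem eigval_le_eigval_add_norm (A B : Herm N) {j : ℕ} (h1 : 1 ≤ j) (hj : j ≤ N) :
    eigval B j ≤ eigval A j + ‖B.1 - A.1‖ := by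
  refine eigval_le_of_quadForm_le B h1 hj (lowerSpan A j) (finrank_lowerSpan A hj).ge
    fun x hx => ?_
  have e : B.1 = A.1 + (B.1 - A.1) := by abel
  rw [e, quadForm_add, ← e, add_mul]
  exact add_le_add (quadForm_le_of_mem_lowerSpan A (fun i hi hij _ => eigval_mono A hi hij hj) hx)
    ((le_abs_self _).trans (abs_quadForm_le _ _))

/-- Weyl's inequality. -/
theorem abs_eigval_sub_le (A B : Herm N) (j : ℕ) : |eigval B j - eigval A j| ≤ ‖B.1 - A.1‖ := by
  by_cases h : 1 ≤ j ∧ j ≤ N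
  · have h1 := eigval_le_eigval_add_norm A B h.1 h.2
    have h2 := eigval_le_eigval_add_norm B A h.1 h.2
    rw [norm_sub_rev] at h2
    rw [abs_le]
    constructor <;> linarith
  · simp [eigval, h]

theorem continuous_eigval (j : ℕ) : Continuous fun A : Herm N => eigval A j := by
  rw [continuous_iff_continuousAt]
  intro A
  have h : Tendsto (fun B : Herm N => ‖B.1 - A.1‖) (𝓝 A) (𝓝 0) := by
    have : Continuous fun B : Herm N => ‖B.1 - A.1‖ :=
      (continuous_subtype_val.sub continuous_const).norm
    simpa using this.tendsto A
  rw [ContinuousAt, tendsto_iff_norm_sub_tendsto_zero]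
  exact squeeze_zero (fun _ => norm_nonneg _) (fun B => abs_eigval_sub_le A B j) h

/-- The test space is the orthogonal complement of the first N - j eigenvectors of A, of dimension
j. Reversing the spectrum later turns upper bounds for -A into lower bounds for A. -/
theorem eigval_neg_le (A : Herm N) {j : ℕ} (h1 : 1 ≤ j) (hj : j ≤ N) :
    eigval ⟨-A.1, A.2.neg⟩ j ≤ -eigval A (N + 1 - j) := by
  let V : Submodule ℂ (EuclideanSpace ℂ (Fin N)) := (lowerSpan A (N - j))ᗮ
  refine eigval_le_of_quadForm_le _ h1 hj V ?_ fun x hx => ?_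
  · have := (lowerSpan A (N - j)).finrank_add_finrank_orthogonal
    rw [finrank_lowerSpan A (by omega), finrank_euclideanSpace_fin] at this
    change j ≤ Module.finrank ℂ (lowerSpan A (N - j))ᗮ
    omega
  · have := le_quadForm_of_inner_eq_zero A (c := eigval A (N + 1 - j)) x fun i hi => by
      refine (Submodule.mem_orthogonal _ x).1 hx _ (Submodule.subset_span ⟨⟨i, ?_⟩, rfl⟩)
      by_contra hcon
      exact absurd (eigval_mono A (by omega : 1 ≤ N + 1 - j) (by omega : N + 1 - j ≤ i + 1)
        (by omega)) (not_le.2 hi)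
    rw [quadForm_neg]
    linarith

/-- The lower bound in the min-max principle. -/
theorem le_eigval_of_le_quadForm (A : Herm N) {j : ℕ} (hj : j ≤ N) {c : ℝ}
    (V : Submodule ℂ (EuclideanSpace ℂ (Fin N))) (hV : N + 1 ≤ Module.finrank ℂ V + j)
    (h : ∀ x ∈ V, c * ‖x‖ ^ 2 ≤ quadForm A.1 x) : c ≤ eigval A j := by
  have hne : V ⊓ lowerSpan A j ≠ ⊥ := fun hbot => by
    have h1 := Submodule.finrank_sup_add_finrank_inf_eq V (lowerSpan A j)
    have h2 := Submodule.finrank_le (V ⊔ lowerSpan A j)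
    rw [hbot, finrank_bot, finrank_lowerSpan A hj] at h1
    rw [finrank_euclideanSpace_fin] at h2
    omega
  obtain ⟨x, hx, hx0⟩ := Submodule.exists_mem_ne_zero_of_ne_bot hne
  have h3 := (h x hx.1).trans
    (quadForm_le_of_mem_lowerSpan A (fun i hi hij _ => eigval_mono A hi hij hj) hx.2)
  exact le_of_mul_le_mul_right h3 (by positivity)

theorem eigval_neg (A : Herm N) {j : ℕ} (h1 : 1 ≤ j) (hj : j ≤ N) :
    eigval ⟨-A.1, A.2.neg⟩ j = -eigval A (N + 1 - j) := by
  refine (eigval_neg_le A h1 hj).antisymm ?_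
  refine le_eigval_of_le_quadForm _ hj (lowerSpan A (N + 1 - j)) ?_ fun x hx => ?_
  · rw [finrank_lowerSpan A (by omega)]
    omega
  · have := quadForm_le_of_mem_lowerSpan A (c := eigval A (N + 1 - j))
      (fun i hi hij _ => eigval_mono A hi hij (by omega)) hx
    rw [quadForm_neg]
    linarith

end Eigenvalues

/-! ### Explicit spectrum of a 2 × 2 Hermitian matrix -/

section TwoByTwo

/-- Half the trace of a `2 × 2` Hermitian matrix. -/
noncomputable def halfTrace (M : Matrix (Fin 2) (Fin 2) ℂ) : ℝ := ((M 0 0).re + (M 1 1).re) / 2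

/-- The Pauli coordinates of the traceless part of a `2 × 2` Hermitian matrix. -/
noncomputable def pauli (M : Matrix (Fin 2) (Fin 2) ℂ) : E3 :=
  !₂[((M 0 0).re - (M 1 1).re) / 2, (M 0 1).re, (M 0 1).im]

theorem halfTrace_neg (M : Matrix (Fin 2) (Fin 2) ℂ) : halfTrace (-M) = -halfTrace M := by
  simp [halfTrace]; ring

theorem norm_pauli_neg (M : Matrix (Fin 2) (Fin 2) ℂ) : ‖pauli (-M)‖ = ‖pauli M‖ := by
  have : pauli (-M) = -pauli M := by
    ext i
    fin_cases i <;> simp [pauli]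
    ring
  rw [this, norm_neg]

theorem norm_sq_pauli (M : Matrix (Fin 2) (Fin 2) ℂ) :
    ‖pauli M‖ ^ 2 = (((M 0 0).re - (M 1 1).re) / 2) ^ 2 + (M 0 1).re ^ 2 + (M 0 1).im ^ 2 := by
  rw [EuclideanSpace.norm_sq_eq]
  simp [Fin.sum_univ_three, pauli]

theorem norm_sq_two (y : EuclideanSpace ℂ (Fin 2)) :
    ‖y‖ ^ 2 = (y 0).re ^ 2 + (y 0).im ^ 2 + ((y 1).re ^ 2 + (y 1).im ^ 2) := by
  rw [EuclideanSpace.norm_sq_eq, Fin.sum_univ_two, ← Complex.normSq_eq_norm_sq,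
    ← Complex.normSq_eq_norm_sq, Complex.normSq_apply, Complex.normSq_apply]
  ring

theorem quadForm_two {M : Matrix (Fin 2) (Fin 2) ℂ} (hM : M.IsHermitian)
    (y : EuclideanSpace ℂ (Fin 2)) : quadForm M y =
      (M 0 0).re * ((y 0).re ^ 2 + (y 0).im ^ 2) + (M 1 1).re * ((y 1).re ^ 2 + (y 1).im ^ 2) +
      2 * ((M 0 1).re * ((y 0).re * (y 1).re + (y 0).im * (y 1).im) +
        (M 0 1).im * ((y 0).im * (y 1).re - (y 0).re * (y 1).im)) := by
  have h10 : M 1 0 = star (M 0 1) := (hM.apply 1 0).symm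
  have h00 : (M 0 0).im = 0 := Complex.conj_eq_iff_im.1 (hM.apply 0 0)
  have h11 : (M 1 1).im = 0 := Complex.conj_eq_iff_im.1 (hM.apply 1 1)
  simp [quadForm, PiLp.inner_apply, Fin.sum_univ_two, mulVec, dotProduct, h10, h00, h11]
  ring

theorem quadForm_two_le {M : Matrix (Fin 2) (Fin 2) ℂ} (hM : M.IsHermitian)
    (y : EuclideanSpace ℂ (Fin 2)) :
    quadForm M y ≤ (halfTrace M + ‖pauli M‖) * ‖y‖ ^ 2 := by
  rw [quadForm_two hM, norm_sq_two, halfTrace]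
  have hr := norm_sq_pauli M
  have hr0 := norm_nonneg (pauli M)
  set r := ‖pauli M‖
  set b := ((M 0 0).re - (M 1 1).re) / 2 with hb
  set p := (M 0 1).re
  set q := (M 0 1).im
  have e0 : (M 0 0).re = ((M 0 0).re + (M 1 1).re) / 2 + b := by rw [hb]; ring
  have e1 : (M 1 1).re = ((M 0 0).re + (M 1 1).re) / 2 - b := by rw [hb]; ring
  set a := ((M 0 0).re + (M 1 1).re) / 2
  rw [e0, e1]
  set s := (y 0).re; set t := (y 0).im; set u := (y 1).re; set v := (y 1).im
  -- Cauchy–Schwarz in ℝ³: the left side pairs the Pauli vector with the Hopf image of y, whose norm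
  -- is ‖y‖². The three squares supplied below are those of Lagrange's identity.
  have key : b * (s ^ 2 + t ^ 2 - u ^ 2 - v ^ 2) +
      p * (2 * (s * u + t * v)) + q * (2 * (t * u - s * v)) ≤
      r * (s ^ 2 + t ^ 2 + (u ^ 2 + v ^ 2)) := by
    apply abs_le_of_sq_le_sq' _ (by positivity) |>.2
    rw [mul_pow, hr]
    nlinarith [sq_nonneg (b * (2 * (s * u + t * v)) - p * (s ^ 2 + t ^ 2 - u ^ 2 - v ^ 2)),
      sq_nonneg (b * (2 * (t * u - s * v)) - q * (s ^ 2 + t ^ 2 - u ^ 2 - v ^ 2)),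
      sq_nonneg (p * (2 * (t * u - s * v)) - q * (2 * (s * u + t * v)))]
  linarith

theorem exists_quadForm_two_le {M : Matrix (Fin 2) (Fin 2) ℂ} (hM : M.IsHermitian) :
    ∃ y : EuclideanSpace ℂ (Fin 2), y ≠ 0 ∧
      quadForm M y ≤ (halfTrace M - ‖pauli M‖) * ‖y‖ ^ 2 := by
  have hr := norm_sq_pauli M
  have hr0 := norm_nonneg (pauli M)
  by_cases h : M 0 1 = 0 ∧ ((M 0 0).re - (M 1 1).re) / 2 + ‖pauli M‖ = 0
  · refine ⟨!₂[1, 0], fun h0 => by simpa using congrArg (fun z => z 0) h0, ?_⟩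
    rw [quadForm_two hM, norm_sq_two, halfTrace]
    simp
    linarith [h.2]
  -- The eigenvector for the lower eigenvalue read off from the first row; it vanishes only in the
  -- case already treated.
  · refine ⟨!₂[-M 0 1, ((((M 0 0).re - (M 1 1).re) / 2 + ‖pauli M‖ : ℝ) : ℂ)], fun h0 => h ?_, ?_⟩
    · have h1 := congrArg (fun z => z 0) h0
      have h2 := congrArg (fun z => z 1) h0
      simp only [cons_val_zero, PiLp.zero_apply, neg_eq_zero, cons_val_one] at h1 h2
      exact ⟨h1, by exact_mod_cast h2⟩
    · rw [quadForm_two hM, norm_sq_two, halfTrace]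
      simp only [cons_val_zero, cons_val_one, Complex.neg_re, Complex.neg_im, Complex.ofReal_re,
        Complex.ofReal_im]
      set r := ‖pauli M‖
      set b := ((M 0 0).re - (M 1 1).re) / 2 with hb
      set p := (M 0 1).re
      set q := (M 0 1).im
      have e0 : (M 0 0).re = ((M 0 0).re + (M 1 1).re) / 2 + b := by rw [hb]; ring
      have e1 : (M 1 1).re = ((M 0 0).re + (M 1 1).re) / 2 - b := by rw [hb]; ring
      set a := ((M 0 0).re + (M 1 1).re) / 2
      rw [e0, e1]
      have hpq : p ^ 2 + q ^ 2 = r ^ 2 - b ^ 2 := by linarith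
      apply le_of_eq
      linear_combination (a + b - 2 * (b + r) - (a - r)) * hpq

end TwoByTwo

/-! ### First-order perturbation of a double eigenvalue -/

section Perturbation

variable {N : ℕ}

theorem inner_frame {k : ℕ} {Q : Matrix (Fin N) (Fin k) ℂ} (hQ : Qᴴ * Q = 1)
    (y z : EuclideanSpace ℂ (Fin k)) :
    inner ℂ (toEuclideanLin Q y) (toEuclideanLin Q z) = inner ℂ y z := by
  rw [inner_toEuclideanLin_left, ← toEuclideanLin_mul_apply, hQ]
  simp

theorem norm_frame {k : ℕ} {Q : Matrix (Fin N) (Fin k) ℂ} (hQ : Qᴴ * Q = 1)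
    (y : EuclideanSpace ℂ (Fin k)) : ‖toEuclideanLin Q y‖ = ‖y‖ := by
  rw [@norm_eq_sqrt_re_inner ℂ, inner_frame hQ, ← @norm_eq_sqrt_re_inner ℂ]

theorem quadForm_frame {k : ℕ} (Q : Matrix (Fin N) (Fin k) ℂ) (B : Matrix (Fin N) (Fin N) ℂ)
    (y : EuclideanSpace ℂ (Fin k)) :
    quadForm B (toEuclideanLin Q y) = quadForm (Qᴴ * B * Q) y := by
  rw [quadForm, quadForm, inner_toEuclideanLin_left, toEuclideanLin_mul_apply,
    toEuclideanLin_mul_apply]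

theorem toEuclideanLin_eigenframe {k : ℕ} {Q : Matrix (Fin N) (Fin k) ℂ}
    {A : Matrix (Fin N) (Fin N) ℂ} {c : ℝ} (hAQ : A * Q = (c : ℂ) • Q)
    (y : EuclideanSpace ℂ (Fin k)) :
    toEuclideanLin A (toEuclideanLin Q y) = (c : ℂ) • toEuclideanLin Q y := by
  rw [← toEuclideanLin_mul_apply, hAQ, map_smul, LinearMap.smul_apply]

theorem inner_eigBasis_eq_zero (A : Herm N) {c : ℝ} {v : EuclideanSpace ℂ (Fin N)}
    (hv : toEuclideanLin A.1 v = (c : ℂ) • v) {i : Fin N} (hi : eigval A (i + 1) ≠ c) :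
    inner ℂ (eigBasis A i) v = 0 := by
  have h := inner_eigBasis_toEuclideanLin A i v
  rw [hv, inner_smul_right] at h
  have h2 : ((eigval A (i + 1) : ℂ) - c) * inner ℂ (eigBasis A i) v = 0 := by
    rw [sub_mul, h, sub_self]
  refine (mul_eq_zero.1 h2).resolve_left fun h3 => hi ?_
  exact_mod_cast sub_eq_zero.1 h3

theorem inner_lowerSpan_eq_zero (A : Herm N) {c : ℝ} {v : EuclideanSpace ℂ (Fin N)}
    (hv : toEuclideanLin A.1 v = (c : ℂ) • v) {p : ℕ}
    (hp : ∀ j, 1 ≤ j → j ≤ p → eigval A j ≠ c) {w : EuclideanSpace ℂ (Fin N)}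
    (hw : w ∈ lowerSpan A p) : inner ℂ w v = 0 := by
  induction hw using Submodule.span_induction with
  | mem x hx =>
    obtain ⟨i, rfl⟩ := hx
    exact inner_eigBasis_eq_zero A hv (hp _ (by omega) i.2)
  | zero => simp
  | add x y _ _ hx hy => rw [inner_add_left, hx, hy, add_zero]
  | smul a x _ hx => rw [inner_smul_left, hx, mul_zero]

/-- The cross term 2‖B‖‖w‖‖v‖ is split by the weighted AM–GM inequality: half the gap pays for the
part in ‖w‖², and 2‖B‖²/g remains on ‖v‖². The bounds 4‖B‖ ≤ g and -‖B‖ ≤ μ make what is left of the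
gap absorb ‖B‖‖w‖². -/
theorem quadForm_add_le {A B : Matrix (Fin N) (Fin N) ℂ} (hA : A.IsHermitian)
    (hB : B.IsHermitian) {c g μ : ℝ} (hg : 0 < g) (hBg : 4 * ‖B‖ ≤ g) (hμ : -‖B‖ ≤ μ)
    {w v : EuclideanSpace ℂ (Fin N)} (hw : quadForm A w ≤ (c - g) * ‖w‖ ^ 2)
    (hv : toEuclideanLin A v = (c : ℂ) • v) (hwv : inner ℂ w v = 0)
    (hBv : quadForm B v ≤ μ * ‖v‖ ^ 2) :
    quadForm (A + B) (w + v) ≤ (c + μ + 2 * ‖B‖ ^ 2 / g) * ‖w + v‖ ^ 2 := by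
  have hn : ‖w + v‖ ^ 2 = ‖w‖ ^ 2 + ‖v‖ ^ 2 := by
    have := norm_add_sq_eq_norm_sq_add_norm_sq_of_inner_eq_zero w v hwv
    simpa only [sq] using this
  have hAv : quadForm A v = c * ‖v‖ ^ 2 := by
    rw [quadForm, hv, inner_smul_right, inner_self_eq_norm_sq_to_K, Complex.re_ofReal_mul]
    norm_cast
  have h1 : quadForm A (w + v) ≤ (c - g) * ‖w‖ ^ 2 + c * ‖v‖ ^ 2 := by
    rw [quadForm_add_vec hA, hAv, hv, inner_smul_right, hwv]
    simpa using hw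
  have h2 : quadForm B (w + v) ≤ ‖B‖ * ‖w‖ ^ 2 + μ * ‖v‖ ^ 2 + 2 * (‖B‖ * ‖w‖ * ‖v‖) := by
    rw [quadForm_add_vec hB]
    have h3 := (le_abs_self _).trans (abs_quadForm_le B w)
    have h4 := (le_abs_self _).trans (abs_inner_toEuclideanLin_le B w v)
    linarith
  rw [quadForm_add, hn]
  have h5 : 2 * (‖B‖ * ‖w‖ * ‖v‖) ≤ g / 2 * ‖w‖ ^ 2 + 2 * ‖B‖ ^ 2 / g * ‖v‖ ^ 2 := by
    have : g / 2 * ‖w‖ ^ 2 + 2 * ‖B‖ ^ 2 / g * ‖v‖ ^ 2 - 2 * (‖B‖ * ‖w‖ * ‖v‖) =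
        2 / g * (g * ‖w‖ / 2 - ‖B‖ * ‖v‖) ^ 2 := by
      field_simp
      ring
    have h6 : 0 ≤ 2 / g * (g * ‖w‖ / 2 - ‖B‖ * ‖v‖) ^ 2 := by positivity
    linarith
  have h7 : 0 ≤ (μ + g / 2 - ‖B‖) * ‖w‖ ^ 2 := mul_nonneg (by linarith) (by positivity)
  have h8 : 0 ≤ 2 * ‖B‖ ^ 2 / g * ‖w‖ ^ 2 := by positivity
  nlinarith

/-- Min-max on the sum of the first n eigenvectors of A and the image of Y under the frame. These
are orthogonal, so the dimension is n + dim Y. Here n counts the eigenvalues known to lie below the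
gap. -/
theorem eigval_add_le (A B : Herm N) {n : ℕ} {c g : ℝ} (hg : 0 < g)
    (hlow : ∀ j, 1 ≤ j → j ≤ n → eigval A j ≤ c - g) {k : ℕ} {Q : Matrix (Fin N) (Fin k) ℂ}
    (hQ : Qᴴ * Q = 1) (hAQ : A.1 * Q = (c : ℂ) • Q) (hBg : 4 * ‖B.1‖ ≤ g)
    (Y : Submodule ℂ (EuclideanSpace ℂ (Fin k))) (hY : Y ≠ ⊥)
    (hN : n + Module.finrank ℂ Y ≤ N) {μ : ℝ}
    (hμ : ∀ y ∈ Y, quadForm (Qᴴ * B.1 * Q) y ≤ μ * ‖y‖ ^ 2) :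
    eigval ⟨A.1 + B.1, A.2.add B.2⟩ (n + Module.finrank ℂ Y) ≤ c + μ + 2 * ‖B.1‖ ^ 2 / g := by
  have hinj : Function.Injective (toEuclideanLin Q) := by
    rw [← LinearMap.ker_eq_bot, LinearMap.ker_eq_bot']
    intro y hy
    rw [← norm_eq_zero, ← norm_frame hQ, hy, norm_zero]
  have hortho : ∀ w ∈ lowerSpan A n, ∀ y, inner ℂ w (toEuclideanLin Q y) = 0 := fun w hw y =>
    inner_lowerSpan_eq_zero A (toEuclideanLin_eigenframe hAQ y)
      (fun j h1 h2 h3 => by have := hlow j h1 h2; linarith) hw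
  have hdisj : lowerSpan A n ⊓ Y.map (toEuclideanLin Q) = ⊥ := by
    rw [eq_bot_iff]
    rintro w ⟨hw, y, -, rfl⟩
    have := hortho _ hw y
    rw [inner_self_eq_zero] at this
    exact this
  have hpos : 0 < Module.finrank ℂ Y := Module.finrank_pos_iff.2 (Submodule.nontrivial_iff_ne_bot.2 hY)
  have hμB : -‖B.1‖ ≤ μ := by
    obtain ⟨y, hy, hy0⟩ := Submodule.exists_mem_ne_zero_of_ne_bot hY
    have h1 := hμ y hy
    rw [← quadForm_frame, ← norm_frame hQ y] at h1
    have h2 := (neg_abs_le _).trans' (neg_le_neg (abs_quadForm_le B.1 (toEuclideanLin Q y)))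
    have h3 : 0 < ‖toEuclideanLin Q y‖ ^ 2 := by rw [norm_frame hQ]; positivity
    refine le_of_mul_le_mul_right ?_ h3
    linarith
  refine eigval_le_of_quadForm_le _ (by omega) hN (lowerSpan A n ⊔ Y.map (toEuclideanLin Q)) ?_ ?_
  · have h1 := Submodule.finrank_sup_add_finrank_inf_eq (lowerSpan A n) (Y.map (toEuclideanLin Q))
    rw [hdisj, finrank_bot, finrank_lowerSpan A (by omega),
      ← (Submodule.equivMapOfInjective _ hinj Y).finrank_eq] at h1
    omega
  · intro x hx
    obtain ⟨w, hw, v, ⟨y, hy, rfl⟩, rfl⟩ := Submodule.mem_sup.1 hx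
    refine quadForm_add_le A.2 B.2 hg hBg hμB ?_ (toEuclideanLin_eigenframe hAQ y)
      (hortho w hw y) ?_
    · exact quadForm_le_of_mem_lowerSpan A (fun j h1 h2 _ => hlow j h1 h2) hw
    · rw [quadForm_frame, norm_frame hQ]
      exact hμ y hy

/-- The upper bounds in first-order perturbation theory of a double eigenvalue. -/
theorem eigval_add_le_pauli (A B : Herm N) {n : ℕ} (hn : 1 ≤ n) (hnN : n + 1 ≤ N) {c g : ℝ}
    (hg : 0 < g) (hlow : ∀ j, 1 ≤ j → j < n → eigval A j ≤ c - g)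
    {Q : Matrix (Fin N) (Fin 2) ℂ} (hQ : Qᴴ * Q = 1) (hAQ : A.1 * Q = (c : ℂ) • Q)
    (hBg : 4 * ‖B.1‖ ≤ g) :
    eigval ⟨A.1 + B.1, A.2.add B.2⟩ n ≤
      c + halfTrace (Qᴴ * B.1 * Q) - ‖pauli (Qᴴ * B.1 * Q)‖ + 2 * ‖B.1‖ ^ 2 / g ∧
    eigval ⟨A.1 + B.1, A.2.add B.2⟩ (n + 1) ≤
      c + halfTrace (Qᴴ * B.1 * Q) + ‖pauli (Qᴴ * B.1 * Q)‖ + 2 * ‖B.1‖ ^ 2 / g := by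
  have hM : (Qᴴ * B.1 * Q).IsHermitian := isHermitian_conjTranspose_mul_mul Q B.2
  have hlow' : ∀ j, 1 ≤ j → j ≤ n - 1 → eigval A j ≤ c - g := fun j h1 h2 =>
    hlow j h1 (by omega)
  -- Now n - 1 eigenvalues lie below the gap. A line Y along a lowest direction of the compression
  -- bounds λ_n, and Y = ℂ² bounds λ_{n+1}.
  constructor
  · obtain ⟨y, hy0, hy⟩ := exists_quadForm_two_le hM
    have hf : Module.finrank ℂ (Submodule.span ℂ {y}) = 1 := finrank_span_singleton hy0
    have h := eigval_add_le A B hg hlow' hQ hAQ hBg (Submodule.span ℂ {y}) (by simpa using hy0)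
      (by omega) (μ := halfTrace (Qᴴ * B.1 * Q) - ‖pauli (Qᴴ * B.1 * Q)‖) fun z hz => by
        obtain ⟨a, rfl⟩ := Submodule.mem_span_singleton.1 hz
        have e : quadForm (Qᴴ * B.1 * Q) (a • y) = ‖a‖ ^ 2 * quadForm (Qᴴ * B.1 * Q) y := by
          rw [quadForm, map_smul, inner_smul_left, inner_smul_right, ← mul_assoc,
            Complex.conj_mul', ← Complex.ofReal_pow, Complex.re_ofReal_mul, quadForm]
        rw [e, norm_smul, mul_pow, mul_left_comm]
        exact mul_le_mul_of_nonneg_left hy (by positivity)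
    rw [hf, Nat.sub_add_cancel hn] at h
    linarith
  · have hf : Module.finrank ℂ (⊤ : Submodule ℂ (EuclideanSpace ℂ (Fin 2))) = 2 := by simp
    have h := eigval_add_le A B hg hlow' hQ hAQ hBg ⊤ top_ne_bot
      (by omega) (μ := halfTrace (Qᴴ * B.1 * Q) + ‖pauli (Qᴴ * B.1 * Q)‖) fun z _ =>
        quadForm_two_le hM z
    rw [hf, show n - 1 + 2 = n + 1 by omega] at h
    linarith

theorem exists_gap_below (A : Herm N) {n : ℕ} (hnN : n ≤ N) {c : ℝ}
    (h : ∀ j, 1 ≤ j → j < n → eigval A j < c) :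
    ∃ g > 0, ∀ j, 1 ≤ j → j < n → eigval A j ≤ c - g := by
  by_cases h2 : 2 ≤ n
  · refine ⟨c - eigval A (n - 1), sub_pos.2 (h _ (by omega) (by omega)), fun j h1 hj => ?_⟩
    have := eigval_mono A h1 (by omega : j ≤ n - 1) (by omega)
    linarith
  · exact ⟨1, one_pos, fun j h1 hj => by omega⟩

/-- First-order perturbation theory of a double eigenvalue. -/
theorem exists_abs_eigval_add_sub_le (A : Herm N) {n : ℕ} (hn : 1 ≤ n) (hnN : n + 1 ≤ N) {c : ℝ}
    (hlow : ∀ j, 1 ≤ j → j < n → eigval A j < c)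
    (hhigh : ∀ j, n + 1 < j → j ≤ N → c < eigval A j)
    {Q : Matrix (Fin N) (Fin 2) ℂ} (hQ : Qᴴ * Q = 1) (hAQ : A.1 * Q = (c : ℂ) • Q) :
    ∃ δ > 0, ∃ K, ∀ B : Herm N, ‖B.1‖ ≤ δ →
      |eigval ⟨A.1 + B.1, A.2.add B.2⟩ n -
        (c + halfTrace (Qᴴ * B.1 * Q) - ‖pauli (Qᴴ * B.1 * Q)‖)| ≤ K * ‖B.1‖ ^ 2 ∧
      |eigval ⟨A.1 + B.1, A.2.add B.2⟩ (n + 1) -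
        (c + halfTrace (Qᴴ * B.1 * Q) + ‖pauli (Qᴴ * B.1 * Q)‖)| ≤ K * ‖B.1‖ ^ 2 := by
  obtain ⟨g₁, hg₁, h₁⟩ := exists_gap_below A (by omega) hlow
  -- The lower bounds are the upper bounds for -A and -B. Negation sends index j to N + 1 - j, so n
  -- becomes N - n and the two branches are exchanged.
  obtain ⟨g₂, hg₂, h₂⟩ := exists_gap_below ⟨-A.1, A.2.neg⟩ (n := N - n) (by omega) (c := -c)
    fun j h1 hj => by
      rw [eigval_neg A h1 (by omega)]
      exact neg_lt_neg (hhigh _ (by omega) (by omega))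
  have hAQ' : (⟨-A.1, A.2.neg⟩ : Herm N).1 * Q = ((-c : ℝ) : ℂ) • Q := by
    simp [hAQ]
  refine ⟨min (g₁ / 4) (g₂ / 4), by positivity, 2 / g₁ + 2 / g₂, fun B hB => ?_⟩
  have hB₁ := hB.trans (min_le_left _ _)
  have hB₂ := hB.trans (min_le_right _ _)
  obtain ⟨u₁, u₂⟩ := eigval_add_le_pauli A B hn hnN hg₁ h₁ hQ hAQ (by linarith)
  obtain ⟨l₁, l₂⟩ := eigval_add_le_pauli ⟨-A.1, A.2.neg⟩ ⟨-B.1, B.2.neg⟩ (n := N - n) (by omega)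
    (by omega) hg₂ h₂ hQ hAQ' (by rw [norm_neg]; linarith)
  have e : (⟨-A.1 + -B.1, A.2.neg.add B.2.neg⟩ : Herm N) =
      ⟨-(A.1 + B.1), (A.2.add B.2).neg⟩ := Subtype.ext (neg_add _ _).symm
  have e2 : Qᴴ * -B.1 * Q = -(Qᴴ * B.1 * Q) := by simp
  rw [e, eigval_neg ⟨A.1 + B.1, A.2.add B.2⟩ (by omega) (by omega), e2, halfTrace_neg,
    norm_pauli_neg, norm_neg] at l₁ l₂
  rw [show N + 1 - (N - n) = n + 1 by omega] at l₁
  rw [show N + 1 - (N - n + 1) = n by omega] at l₂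
  have p₁ : 0 ≤ 2 / g₁ * ‖B.1‖ ^ 2 := by positivity
  have p₂ : 0 ≤ 2 / g₂ * ‖B.1‖ ^ 2 := by positivity
  rw [mul_div_right_comm] at u₁ u₂ l₁ l₂
  rw [add_mul]
  constructor <;> rw [abs_le] <;> constructor <;> linarith

end Perturbation

/-! ### Multiplicity counted by orthonormal frames -/

section Multiplicity

variable {N : ℕ}

/-- The multiplicity of `c` as an eigenvalue of `A`, counted on the ordered list of eigenvalues. -/
noncomputable def eigMult (A : Herm N) (c : ℝ) : ℕ :=
  (Finset.univ.filter fun i : Fin N => eigval A (i + 1) = c).card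

theorem rootMultiplicity_charpoly (A : Herm N) (c : ℝ) :
    (A : Matrix (Fin N) (Fin N) ℂ).charpoly.rootMultiplicity (c : ℂ) = eigMult A c := by
  rw [← Polynomial.count_roots, A.2.roots_charpoly_eq_eigenvalues, Multiset.count_map,
    ← Finset.filter_val, Finset.card_val, eigMult]
  refine (Finset.card_equiv (sortPerm N) fun i => ?_).symm
  simp only [Finset.mem_filter, Finset.mem_univ, true_and, Function.comp_apply,
    eigenvalues_sortPerm]
  exact ⟨fun h => by rw [h]; rfl, fun h => (Complex.ofReal_injective h).symm⟩

/-- A vector of the eigenspace has coordinates only along the basis eigenvectors with eigenvalue c,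
so a k-frame embeds ℂ^k in the span of those; conversely any k of them form a frame. In this form
multiplicity is a closed condition over a compact set. -/
theorem exists_frame_iff (A : Herm N) (c : ℝ) (k : ℕ) :
    (∃ Q : Matrix (Fin N) (Fin k) ℂ, Qᴴ * Q = 1 ∧ A.1 * Q = (c : ℂ) • Q) ↔ k ≤ eigMult A c := by
  constructor
  · rintro ⟨Q, hQ, hAQ⟩
    let f : EuclideanSpace ℂ (Fin k) →ₗ[ℂ] ({i : Fin N // eigval A (i + 1) = c} → ℂ) :=
      LinearMap.pi fun i => (innerₛₗ ℂ (eigBasis A i)).comp (toEuclideanLin Q)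
    have hf : Function.Injective f := by
      rw [← LinearMap.ker_eq_bot, LinearMap.ker_eq_bot']
      intro y hy
      have h0 : ∀ i, inner ℂ (eigBasis A i) (toEuclideanLin Q y) = 0 := fun i => by
        by_cases hi : eigval A (i + 1) = c
        · exact congrFun hy ⟨i, hi⟩
        · exact inner_eigBasis_eq_zero A (toEuclideanLin_eigenframe hAQ y) hi
      have h1 := (eigBasis A).sum_sq_norm_inner_right (toEuclideanLin Q y)
      simp only [h0, norm_zero, norm_frame hQ] at h1
      simpa using h1.symm
    have h := LinearMap.finrank_le_finrank_of_injective hf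
    rwa [finrank_euclideanSpace_fin, Module.finrank_fintype_fun_eq_card,
      Fintype.card_subtype] at h
  · intro hk
    obtain ⟨s, hs, hsk⟩ := Finset.exists_subset_card_eq hk
    let e := s.orderEmbOfFin hsk
    have he : ∀ j, eigval A (e j + 1) = c := fun j =>
      (Finset.mem_filter.1 (hs (Finset.orderEmbOfFin_mem s hsk j))).2
    refine ⟨Matrix.of fun i j => eigBasis A (e j) i, ?_, ?_⟩
    · ext i j
      have h := orthonormal_iff_ite.1 (eigBasis A).orthonormal (e i) (e j)
      rw [PiLp.inner_apply] at h
      simp only [e.injective.eq_iff] at h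
      rw [Matrix.one_apply, ← h, Matrix.mul_apply]
      refine Finset.sum_congr rfl fun l _ => ?_
      simp [mul_comm]
    · ext i j
      have h := congrArg (fun z => z i) (toEuclideanLin_eigBasis A (e j))
      rw [he j] at h
      simpa [Matrix.mul_apply, mulVec, dotProduct] using h

theorem two_le_eigMult (A : Herm N) {n : ℕ} (hn : 1 ≤ n) (hnN : n + 1 ≤ N)
    (h : eigval A n = eigval A (n + 1)) : 2 ≤ eigMult A (eigval A n) := by
  -- Positions in `Fin N` start at zero: λ_n and λ_{n+1} sit at n - 1 and n.
  have : ({⟨n - 1, by omega⟩, ⟨n, by omega⟩} : Finset (Fin N)) ⊆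
      Finset.univ.filter fun i : Fin N => eigval A (i + 1) = eigval A n := by
    intro i hi
    rw [Finset.mem_insert, Finset.mem_singleton] at hi
    rw [Finset.mem_filter]
    refine ⟨Finset.mem_univ _, ?_⟩
    rcases hi with rfl | rfl
    · simp [Nat.sub_add_cancel hn]
    · exact h.symm
  refine (Finset.card_pair ?_).symm.le.trans (Finset.card_le_card this)
  simp only [ne_eq, Fin.mk.injEq]
  omega

theorem eigval_ne_of_eigMult_le_two (A : Herm N) {n : ℕ} (hn : 1 ≤ n) (hnN : n + 1 ≤ N)
    (h : eigval A n = eigval A (n + 1)) (h2 : eigMult A (eigval A n) ≤ 2) {j : ℕ} (hj : 1 ≤ j)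
    (hjN : j ≤ N) (h3 : j ≠ n) (h4 : j ≠ n + 1) : eigval A j ≠ eigval A n := by
  intro hc
  have : ({⟨n - 1, by omega⟩, ⟨n, by omega⟩, ⟨j - 1, by omega⟩} : Finset (Fin N)) ⊆
      Finset.univ.filter fun i : Fin N => eigval A (i + 1) = eigval A n := by
    intro i hi
    simp only [Finset.mem_insert, Finset.mem_singleton] at hi
    rw [Finset.mem_filter]
    refine ⟨Finset.mem_univ _, ?_⟩
    rcases hi with rfl | rfl | rfl
    · simp [Nat.sub_add_cancel hn]
    · exact h.symm
    · simpa [Nat.sub_add_cancel hj] using hc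
  have h5 := (Finset.card_le_card this).trans h2
  rw [Finset.card_eq_three.2 ⟨_, _, _, _, _, _, rfl⟩] at h5
  · omega
  all_goals simp only [ne_eq, Fin.mk.injEq]; omega

end Multiplicity

/-! ### Linear jets and homogeneity -/

section Jets

/-- The linear map `ε ↦ ∑ εᵢ Bᵢ`. -/
noncomputable def jetMap {F : Type*} [AddCommGroup F] [Module ℝ F] (B : Fin 3 → F) :
    E3 →ₗ[ℝ] F where
  toFun ε := ∑ i, ε i • B i
  map_add' x y := by simp [add_smul, Finset.sum_add_distrib]
  map_smul' c x := by simp [mul_smul, Finset.smul_sum]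

theorem jetMap_apply {F : Type*} [AddCommGroup F] [Module ℝ F] (B : Fin 3 → F) (ε : E3) :
    jetMap B ε = ∑ i, ε i • B i := rfl

theorem exists_bound_linearMap {E F : Type*} [NormedAddCommGroup E] [NormedSpace ℝ E]
    [FiniteDimensional ℝ E] [NormedAddCommGroup F] [NormedSpace ℝ F] (f : E →ₗ[ℝ] F) :
    ∃ C : ℝ, ∀ x, ‖f x‖ ≤ C * ‖x‖ :=
  ⟨‖LinearMap.toContinuousLinearMap f‖, (LinearMap.toContinuousLinearMap f).le_opNorm⟩

/-- Both norms are homogeneous of degree one: along the ray tε with t → 0⁺, dividing by t turns the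
hypothesis into a constant that is o(1). -/
theorem norm_eq_of_isLittleO {F G : Type*} [NormedAddCommGroup F] [NormedSpace ℝ F]
    [NormedAddCommGroup G] [NormedSpace ℝ G] (f : E3 →ₗ[ℝ] F) (g : E3 →ₗ[ℝ] G)
    (h : (fun ε => ‖f ε‖ - ‖g ε‖) =o[𝓝 0] fun ε : E3 => ε) (ε : E3) : ‖f ε‖ = ‖g ε‖ := by
  have ht : Tendsto (fun t : ℝ => t • ε) (𝓝[>] 0) (𝓝 0) := by
    have : Tendsto (fun t : ℝ => t • ε) (𝓝 0) (𝓝 ((0 : ℝ) • ε)) :=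
      (continuous_id.smul continuous_const).tendsto 0
    rw [zero_smul] at this
    exact this.mono_left nhdsWithin_le_nhds
  have h1 := h.comp_tendsto ht
  have h2 : (fun _ : ℝ => ‖f ε‖ - ‖g ε‖) =o[𝓝[>] (0 : ℝ)] fun _ : ℝ => (1 : ℝ) := by
    rw [isLittleO_iff]
    intro c hc
    have h3 := (isLittleO_iff.1 h1) (c := c / (‖ε‖ + 1)) (by positivity)
    filter_upwards [h3, self_mem_nhdsWithin] with t ht1 ht2
    have ht0 : (0 : ℝ) < t := ht2
    simp only [Function.comp_apply, map_smul, norm_smul, ← mul_sub] at ht1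
    rw [Real.norm_of_nonneg ht0.le, norm_mul, Real.norm_of_nonneg ht0.le] at ht1
    have h4 : c / (‖ε‖ + 1) * ‖ε‖ ≤ c := by
      rw [div_mul_eq_mul_div, div_le_iff₀ (by positivity)]
      nlinarith [norm_nonneg ε]
    rw [norm_one, mul_one]
    refine le_of_mul_le_mul_left (ht1.trans ?_) ht0
    rw [mul_left_comm]
    gcongr
  have h5 := (isLittleO_const_left.1 h2).resolve_right (by
    intro h6
    rw [show (norm ∘ fun _ : ℝ => (1 : ℝ)) = fun _ => (1 : ℝ) by funext; simp] at h6
    exact not_tendsto_const_atTop (1 : ℝ) _ h6)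
  linarith

end Jets

/-! ### Conical crossings as nondegenerate jets -/

section Conical

variable {N : ℕ}

/-- The traceless part of the compression of a matrix to the range of a frame. -/
noncomputable def pauliCompression (Q : Matrix (Fin N) (Fin 2) ℂ) :
    Matrix (Fin N) (Fin N) ℂ →ₗ[ℝ] E3 where
  toFun M := pauli (Qᴴ * M * Q)
  map_add' x y := by
    rw [Matrix.mul_add, Matrix.add_mul]
    ext i
    fin_cases i <;> simp [pauli]
    ring
  map_smul' c x := by
    rw [Matrix.mul_smul, Matrix.smul_mul]
    ext i
    fin_cases i <;> simp [pauli]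
    ring

/-- Half the trace of the compression of a matrix to the range of a frame. -/
noncomputable def traceCompression (Q : Matrix (Fin N) (Fin 2) ℂ) :
    Matrix (Fin N) (Fin N) ℂ →ₗ[ℝ] ℝ where
  toFun M := halfTrace (Qᴴ * M * Q)
  map_add' x y := by
    rw [Matrix.mul_add, Matrix.add_mul]
    simp [halfTrace]
    ring
  map_smul' c x := by
    rw [Matrix.mul_smul, Matrix.smul_mul]
    simp [halfTrace]
    ring

/-- The eigenvalue `c` of `A` is either at least triple, or double with a first-order splitting
along `B` that vanishes in some direction. -/
def Degenerate (c : ℝ) (A : Matrix (Fin N) (Fin N) ℂ) (B : Fin 3 → Matrix (Fin N) (Fin N) ℂ) :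
    Prop :=
  (∃ Q : Matrix (Fin N) (Fin 3) ℂ, Qᴴ * Q = 1 ∧ A * Q = (c : ℂ) • Q) ∨
  ∃ (Q : Matrix (Fin N) (Fin 2) ℂ) (ε : E3), Qᴴ * Q = 1 ∧ A * Q = (c : ℂ) • Q ∧ ‖ε‖ = 1 ∧
    pauliCompression Q (jetMap B ε) = 0

/-- Perturbation theory with B = G(ε) - A, which is O(ε): the error K‖B‖² is o(ε), and replacing B
by its linear part changes the compressions by o(ε). The filter is left general so as to allow
one-sided neighbourhoods. -/
theorem isLittleO_eigval_sub {n : ℕ} (hn : 1 ≤ n) (hnN : n + 1 ≤ N) (A : Herm N)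
    (hA : eigval A n = eigval A (n + 1)) (hA2 : eigMult A (eigval A n) ≤ 2)
    {Q : Matrix (Fin N) (Fin 2) ℂ} (hQ : Qᴴ * Q = 1)
    (hAQ : A.1 * Q = (eigval A n : ℂ) • Q) {B : Fin 3 → Matrix (Fin N) (Fin N) ℂ}
    {l : Filter E3} (hl : l ≤ 𝓝 0) {G : E3 → Herm N}
    (hG : (fun ε => (G ε).1 - A.1 - jetMap B ε) =o[l] fun ε => ε) :
    ((fun ε => eigval (G ε) n - (eigval A n + traceCompression Q (jetMap B ε) -
      ‖pauliCompression Q (jetMap B ε)‖)) =o[l] fun ε => ε) ∧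
    ((fun ε => eigval (G ε) (n + 1) - (eigval A n + traceCompression Q (jetMap B ε) +
      ‖pauliCompression Q (jetMap B ε)‖)) =o[l] fun ε => ε) := by
  obtain ⟨δ, hδ, K, hK⟩ := exists_abs_eigval_add_sub_le A hn hnN (c := eigval A n)
    (fun j h1 hj => (eigval_mono A h1 hj.le (by omega)).lt_of_ne
      (eigval_ne_of_eigMult_le_two A hn hnN hA hA2 h1 (by omega) (by omega) (by omega)))
    (fun j h1 hj => (eigval_mono A hn (by omega) hj).lt_of_ne
      (eigval_ne_of_eigMult_le_two A hn hnN hA hA2 (by omega) hj (by omega) (by omega)).symm)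
    hQ hAQ
  obtain ⟨C₁, hC₁⟩ := exists_bound_linearMap (jetMap B)
  obtain ⟨C₂, hC₂⟩ := exists_bound_linearMap (pauliCompression Q)
  obtain ⟨C₃, hC₃⟩ := exists_bound_linearMap (traceCompression Q)
  have hid : Tendsto (fun ε : E3 => ε) l (𝓝 0) := hl
  have hjet : (fun ε => jetMap B ε) =O[l] fun ε : E3 => ε :=
    IsBigO.of_bound C₁ (Eventually.of_forall hC₁)
  have hR : (fun ε => (G ε).1 - A.1) =O[l] fun ε : E3 => ε := by
    have := hG.isBigO.add hjet
    simpa using this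
  have hR0 : Tendsto (fun ε => (G ε).1 - A.1) l (𝓝 0) := hR.trans_tendsto hid
  have hsmall : ∀ᶠ ε in l, ‖(G ε).1 - A.1‖ ≤ δ := by
    have h1 := hR0.norm
    rw [norm_zero] at h1
    exact h1.eventually_le_const hδ
  have hsq : (fun ε => K * ‖(G ε).1 - A.1‖ ^ 2) =o[l] fun ε : E3 => ε := by
    have h1 : (fun ε => ‖(G ε).1 - A.1‖ ^ 2) =O[l] fun ε : E3 => ‖ε‖ ^ 2 := hR.norm_norm.pow 2
    have h2 : (fun ε : E3 => ‖ε‖ ^ 2) =o[l] fun ε : E3 => ε :=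
      (isLittleO_norm_pow_id one_lt_two).mono hl
    exact (h1.trans_isLittleO h2).const_mul_left K
  have ht : (fun ε => traceCompression Q ((G ε).1 - A.1) - traceCompression Q (jetMap B ε))
      =o[l] fun ε : E3 => ε := by
    refine IsBigO.trans_isLittleO (IsBigO.of_bound C₃ (Eventually.of_forall fun ε => ?_)) hG
    rw [← map_sub]
    exact hC₃ _
  have hp : (fun ε => ‖pauliCompression Q ((G ε).1 - A.1)‖ - ‖pauliCompression Q (jetMap B ε)‖)
      =o[l] fun ε : E3 => ε := by
    refine IsBigO.trans_isLittleO (IsBigO.of_bound C₂ (Eventually.of_forall fun ε => ?_)) hG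
    refine (abs_norm_sub_norm_le _ _).trans ?_
    rw [← map_sub]
    exact hC₂ _
  have key : ∀ᶠ ε in l,
      |eigval (G ε) n - (eigval A n + traceCompression Q ((G ε).1 - A.1) -
        ‖pauliCompression Q ((G ε).1 - A.1)‖)| ≤ K * ‖(G ε).1 - A.1‖ ^ 2 ∧
      |eigval (G ε) (n + 1) - (eigval A n + traceCompression Q ((G ε).1 - A.1) +
        ‖pauliCompression Q ((G ε).1 - A.1)‖)| ≤ K * ‖(G ε).1 - A.1‖ ^ 2 := by
    filter_upwards [hsmall] with ε hε
    have h1 := hK ⟨(G ε).1 - A.1, (G ε).2.sub A.2⟩ hε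
    have h2 : (⟨A.1 + ((G ε).1 - A.1), A.2.add ((G ε).2.sub A.2)⟩ : Herm N) = G ε :=
      Subtype.ext (add_sub_cancel _ _)
    rw [h2] at h1
    exact h1
  have k₁ : (fun ε => eigval (G ε) n - (eigval A n + traceCompression Q ((G ε).1 - A.1) -
      ‖pauliCompression Q ((G ε).1 - A.1)‖)) =o[l] fun ε : E3 => ε :=
    (IsBigO.of_bound 1 (key.mono fun ε h => by
      rw [one_mul]; exact h.1.trans (le_abs_self _))).trans_isLittleO hsq
  have k₂ : (fun ε => eigval (G ε) (n + 1) - (eigval A n + traceCompression Q ((G ε).1 - A.1) +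
      ‖pauliCompression Q ((G ε).1 - A.1)‖)) =o[l] fun ε : E3 => ε :=
    (IsBigO.of_bound 1 (key.mono fun ε h => by
      rw [one_mul]; exact h.2.trans (le_abs_self _))).trans_isLittleO hsq
  constructor
  · refine ((k₁.add ht).sub hp).congr_left fun ε => ?_
    ring
  · refine ((k₂.add ht).add hp).congr_left fun ε => ?_
    ring

/-- The cone is explicit: S₀ is the Pauli compression of the derivative, injective by nondegeneracy
and hence invertible, and a₀ represents the functional given by half the trace. -/
theorem crossesConically_of_not_degenerate {n : ℕ} (hn : 1 ≤ n) (hnN : n + 1 ≤ N)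
    {H : CylinderFamily N} {ζ₀ : Cylinder} (hc : Crosses n H ζ₀)
    {B : Fin 3 → Matrix (Fin N) (Fin N) ℂ}
    (hB : (fun ε => (H (shift ζ₀ ε)).1 - (H ζ₀).1 - jetMap B ε) =o[𝓝[admissible ζ₀] 0]
      fun ε => ε)
    (hd : ¬ Degenerate (eigval (H ζ₀) n) (H ζ₀).1 B) : CrossesConically n H ζ₀ := by
  rw [Degenerate, not_or] at hd
  have h2 := two_le_eigMult (H ζ₀) hn hnN hc
  have h3 : eigMult (H ζ₀) (eigval (H ζ₀) n) ≤ 2 := by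
    by_contra h
    exact hd.1 ((exists_frame_iff _ _ _).2 (by omega))
  obtain ⟨Q, hQ, hAQ⟩ := (exists_frame_iff _ _ _).2 h2
  refine ⟨hc, by rw [rootMultiplicity_charpoly]; omega, ?_⟩
  obtain ⟨e₁, e₂⟩ := isLittleO_eigval_sub hn hnN (H ζ₀) hc h3 hQ hAQ nhdsWithin_le_nhds hB
  let L : E3 →ₗ[ℝ] E3 := (pauliCompression Q).comp (jetMap B)
  let t : E3 →ₗ[ℝ] ℝ := (traceCompression Q).comp (jetMap B)
  have hL : Function.Injective L := by
    rw [← LinearMap.ker_eq_bot, LinearMap.ker_eq_bot']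
    intro ε hε
    by_contra h0
    refine hd.2 ⟨Q, ‖ε‖⁻¹ • ε, hQ, hAQ, ?_, ?_⟩
    · rw [norm_smul, norm_inv, norm_norm, inv_mul_cancel₀ (norm_ne_zero_iff.2 h0)]
    · change L (‖ε‖⁻¹ • ε) = 0
      rw [map_smul, hε, smul_zero]
  have hS : ∀ ε, toEuclideanLin (toEuclideanLin.symm L) ε = L ε := fun ε => by
    rw [LinearEquiv.apply_symm_apply]
  have ha : ∀ ε, inner ℝ ((InnerProductSpace.toDual ℝ E3).symm
      (LinearMap.toContinuousLinearMap t)) ε = t ε := fun ε => by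
    rw [InnerProductSpace.toDual_symm_apply]
    rfl
  refine ⟨(InnerProductSpace.toDual ℝ E3).symm (LinearMap.toContinuousLinearMap t),
    toEuclideanLin.symm L, ?_, ?_, ?_⟩
  · rw [← mulVec_injective_iff_isUnit]
    intro x y hxy
    have h : toEuclideanLin (toEuclideanLin.symm L) (WithLp.toLp 2 x) =
        toEuclideanLin (toEuclideanLin.symm L) (WithLp.toLp 2 y) := by
      rw [toLpLin_apply, toLpLin_apply]
      exact congrArg (WithLp.toLp 2) hxy
    rw [hS, hS] at h
    exact WithLp.toLp_injective 2 (hL h)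
  · simp only [hS, ha]
    exact e₁
  · simp only [hS, ha]
    exact e₂

/-- Half the difference of the two branches shows that ‖S₀ε‖ equals the norm of the Pauli
compression along ε, first up to o(ε) and then exactly by homogeneity. A direction that kills the
compression would therefore kill S₀. Interiority makes all directions ε available. -/
theorem not_degenerate_of_crossesConically {n : ℕ} (hn : 1 ≤ n) (hnN : n + 1 ≤ N)
    {H : CylinderFamily N} {ζ₀ : Cylinder} (hc : CrossesConically n H ζ₀)
    (hint : admissible ζ₀ ∈ 𝓝 (0 : E3)) {B : Fin 3 → Matrix (Fin N) (Fin N) ℂ}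
    (hB : (fun ε => (H (shift ζ₀ ε)).1 - (H ζ₀).1 - jetMap B ε) =o[𝓝[admissible ζ₀] 0]
      fun ε => ε) :
    ¬ Degenerate (eigval (H ζ₀) n) (H ζ₀).1 B := by
  obtain ⟨hcr, hm, a₀, S₀, hS₀, f₁, f₂⟩ := hc
  rw [rootMultiplicity_charpoly] at hm
  rintro (⟨Q, hQ⟩ | ⟨Q, ε, hQ, hAQ, hε, hz⟩)
  · have := (exists_frame_iff (H ζ₀) (eigval (H ζ₀) n) 3).1 ⟨Q, hQ⟩
    omega
  · obtain ⟨e₁, e₂⟩ := isLittleO_eigval_sub hn hnN (H ζ₀) hcr hm.le hQ hAQ nhdsWithin_le_nhds hB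
    rw [nhdsWithin_eq_nhds.2 hint] at e₁ e₂ f₁ f₂
    have h : (fun ε => ‖toEuclideanLin S₀ ε‖ -
        ‖((pauliCompression Q).comp (jetMap B)) ε‖) =o[𝓝 0] fun ε : E3 => ε := by
      refine (((e₂.sub e₁).sub (f₂.sub f₁)).const_mul_left (1 / 2)).congr_left fun ε => ?_
      simp only [LinearMap.comp_apply]
      ring
    have h1 := norm_eq_of_isLittleO _ _ h ε
    rw [LinearMap.comp_apply, hz, norm_zero, norm_eq_zero] at h1
    have h2 : S₀ *ᵥ ε.ofLp = S₀ *ᵥ 0 := by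
      rw [mulVec_zero]
      exact congrArg WithLp.ofLp h1
    have h3 := mulVec_injective_iff_isUnit.2 hS₀ h2
    have h4 : ε = 0 := by
      ext i
      exact congrFun h3 i
    rw [h4, norm_zero] at hε
    exact zero_ne_one hε

end Conical

/-! ### Partial derivatives on the slab -/

section PartialDerivatives

variable {F : Type*} [NormedAddCommGroup F] [NormedSpace ℝ F]

/-- The `i`-th partial derivative of a function on the slab. -/
noncomputable def partialDeriv (f : E3 → F) (i : Fin 3) (x : E3) : F :=
  fderivWithin ℝ f slab x (EuclideanSpace.single i 1)

theorem jetMap_clm (L : E3 →L[ℝ] F) (ε : E3) :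
    jetMap (fun i => L (EuclideanSpace.single i 1)) ε = L ε := by
  have h : ε = ∑ i, ε i • EuclideanSpace.single i (1 : ℝ) := by
    ext j
    fin_cases j <;> simp [Fin.sum_univ_three]
  conv_rhs => rw [h]
  simp [jetMap_apply]

theorem isLittleO_sub_jetMap {f : E3 → F} {s : Set E3} {x : E3} {L : E3 →L[ℝ] F}
    (h : HasFDerivWithinAt f L s x) :
    (fun ε => f (x + ε) - f x - jetMap (fun i => L (EuclideanSpace.single i 1)) ε)
      =o[𝓝[{ε | x + ε ∈ s}] 0] fun ε => ε := by
  have ht : Tendsto (fun ε => x + ε) (𝓝[{ε | x + ε ∈ s}] 0) (𝓝[s] x) := by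
    refine tendsto_nhdsWithin_iff.2 ⟨?_, self_mem_nhdsWithin⟩
    have : Tendsto (fun ε => x + ε) (𝓝 0) (𝓝 (x + 0)) :=
      (continuous_const.add continuous_id).tendsto 0
    rw [add_zero] at this
    exact this.mono_left nhdsWithin_le_nhds
  refine (h.isLittleO.comp_tendsto ht).congr (fun ε => ?_) fun ε => ?_
  · simp [jetMap_clm]
  · simp

theorem norm_partialDeriv_sub_le {f g : E3 → F} (hf : DifferentiableOn ℝ f slab)
    (hg : DifferentiableOn ℝ g slab) (i : Fin 3) {x : E3} (hx : x ∈ slab) :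
    ‖partialDeriv f i x - partialDeriv g i x‖ ≤
      ‖iteratedFDerivWithin ℝ 1 (fun y => f y - g y) slab x‖ := by
  have hu := uniqueDiffOn_slab x hx
  rw [norm_iteratedFDerivWithin_one _ hu, fderivWithin_fun_sub hu (hf x hx) (hg x hx),
    partialDeriv, partialDeriv, ← _root_.sub_apply]
  refine (ContinuousLinearMap.le_opNorm _ _).trans ?_
  simp

theorem tendsto_norm_partialDeriv_sub {f : E3 → F} (hf : ContDiffOn ℝ ∞ f slab) (i : Fin 3)
    (x : slab) :
    Tendsto (fun y : slab => ‖partialDeriv f i y - partialDeriv f i x‖) (𝓝 x) (𝓝 0) := by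
  have h1 : ContinuousOn (fun y => partialDeriv f i y) slab :=
    (hf.continuousOn_fderivWithin uniqueDiffOn_slab (by simp)).clm_apply continuousOn_const
  have h2 : Continuous fun y : slab => partialDeriv f i y := continuousOn_iff_continuous_domRestrict.1 h1
  exact tendsto_iff_norm_sub_tendsto_zero.1 (h2.tendsto x)

theorem tendsto_norm_sub {f : E3 → F} (hf : ContDiffOn ℝ ∞ f slab) (x : slab) :
    Tendsto (fun y : slab => ‖f y - f x‖) (𝓝 x) (𝓝 0) := by
  have h2 : Continuous fun y : slab => f y :=
    continuousOn_iff_continuous_domRestrict.1 hf.continuousOn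
  exact tendsto_iff_norm_sub_tendsto_zero.1 (h2.tendsto x)

end PartialDerivatives

/-! ### Points of the cylinder and of its cover -/

section Points

/-- The projection of the slab to `[0,1] × 𝕋²`. -/
noncomputable def toCylinder (x : E3) : Cylinder := lift id x

theorem exists_toCylinder_eq (ζ : Cylinder) : ∃ x ∈ slab, toCylinder x = ζ := by
  obtain ⟨⟨s, hs⟩, ξ, η⟩ := ζ
  induction ξ using QuotientAddGroup.induction_on with | _ ξ =>
  induction η using QuotientAddGroup.induction_on with | _ η =>
  refine ⟨!₂[s, ξ, η], by simpa [slab] using hs, ?_⟩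
  simp [toCylinder, lift, Set.projIcc_of_mem zero_le_one hs]

theorem exists_toCylinder_eq_norm_le (ζ : Cylinder) :
    ∃ x ∈ slab, ‖x‖ ≤ 1 + 4 * Real.pi ∧ toCylinder x = ζ := by
  obtain ⟨x, hx, rfl⟩ := exists_toCylinder_eq ζ
  obtain ⟨a, h0, h1, h2, h3, h4⟩ := exists_period x hx
  exact ⟨a + x, h3, h4, lift_add id a x h0 h1 h2⟩

theorem toCylinder_add {x : E3} (hx : x ∈ slab) (ε : E3) :
    toCylinder (x + ε) = shift (toCylinder x) ε := by
  have h : (Set.projIcc (0 : ℝ) 1 zero_le_one (x 0) : ℝ) = x 0 := by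
    rw [Set.projIcc_of_mem zero_le_one hx]
  simp [toCylinder, lift, shift, h]

theorem toCylinder_fst {x : E3} (hx : x ∈ slab) : ((toCylinder x).1 : ℝ) = x 0 := by
  simp [toCylinder, lift, Set.projIcc_of_mem zero_le_one (show x 0 ∈ Set.Icc (0 : ℝ) 1 from hx)]

theorem admissible_toCylinder {x : E3} (hx : x ∈ slab) :
    admissible (toCylinder x) = {ε | x + ε ∈ slab} := by
  ext ε
  simp [admissible, slab, toCylinder_fst hx]

theorem admissible_mem_nhds {ζ : Cylinder} (h0 : 0 < (ζ.1 : ℝ)) (h1 : (ζ.1 : ℝ) < 1) :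
    admissible ζ ∈ 𝓝 (0 : E3) := by
  have hc : Continuous fun ε : E3 => (ζ.1 : ℝ) + ε 0 := by fun_prop
  refine mem_of_superset ((isOpen_Ioo.preimage hc).mem_nhds ?_)
    (Set.preimage_mono Set.Ioo_subset_Icc_self : _ ⊆ _ ⁻¹' Set.Icc (0 : ℝ) 1)
  simpa using ⟨h0, h1⟩

end Points

/-! ### Joint continuity of the 1-jet -/

section Families

variable {N : ℕ}

theorem CylinderFamily.mat_eq (H : CylinderFamily N) (x : E3) : H.mat x = (H (toCylinder x)).1 :=
  rfl

theorem CylinderFamily.differentiableOn (H : CylinderFamily N) : DifferentiableOn ℝ H.mat slab :=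
  ContDiffOn.differentiableOn (F := Matrix (Fin N) (Fin N) ℂ) H.smooth (by simp)

theorem CylinderFamily.isLittleO (H : CylinderFamily N) {x : E3} (hx : x ∈ slab) :
    (fun ε => (H (shift (toCylinder x) ε)).1 - (H (toCylinder x)).1 -
      jetMap (fun i => partialDeriv H.mat i x) ε) =o[𝓝[admissible (toCylinder x)] 0]
        fun ε => ε := by
  have h := isLittleO_sub_jetMap (F := Matrix (Fin N) (Fin N) ℂ)
    (H.differentiableOn x hx).hasFDerivWithinAt
  rw [admissible_toCylinder hx]
  simp only [CylinderFamily.mat_eq, toCylinder_add hx] at h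
  exact h

theorem tendsto_ckNorm (k : ℕ) (H : CylinderFamily N) :
    Tendsto (fun H' : CylinderFamily N => ckNorm k (fun x => H'.mat x - H.mat x)) (𝓝 H) (𝓝 0) := by
  have hu : Tendsto (fun H' : CylinderFamily N => (2 : ℝ) ^ k * dist H' H) (𝓝 H) (𝓝 0) := by
    have h1 : Continuous fun H' : CylinderFamily N => (2 : ℝ) ^ k * dist H' H := by fun_prop
    simpa using h1.tendsto H
  have h2 : Tendsto (fun H' : CylinderFamily N => 2 * ((2 : ℝ) ^ k * dist H' H)) (𝓝 H) (𝓝 0) := by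
    simpa using hu.const_mul 2
  refine squeeze_zero' (Eventually.of_forall fun _ => ckNorm_nonneg _ _) ?_ h2
  -- One term of the series is at most its sum, so t/(1 + t) ≤ u with u = 2^k d. Once u < 1/2 this
  -- gives t ≤ 2u.
  filter_upwards [hu.eventually_lt_const (by norm_num : (0 : ℝ) < 1 / 2)] with H' hH'
  have h3 : (2 : ℝ)⁻¹ ^ k * (ckNorm k (fun x => H'.mat x - H.mat x) /
      (1 + ckNorm k (fun x => H'.mat x - H.mat x))) ≤ dist H' H :=
    (summable_cinftyDist H' H).le_tsum k fun j _ =>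
      mul_nonneg (by positivity) (div_one_add_nonneg (ckNorm_nonneg _ _))
  have h4 := ckNorm_nonneg k (fun x => H'.mat x - H.mat x)
  set t := ckNorm k (fun x => H'.mat x - H.mat x)
  rw [inv_pow, inv_mul_le_iff₀ (by positivity), div_le_iff₀ (by positivity)] at h3
  set u := (2 : ℝ) ^ k * dist H' H
  nlinarith

/-- The value and the partial derivatives of a family at a point of the slab. -/
noncomputable def jet (p : CylinderFamily N × slab) :
    Herm N × (Fin 3 → Matrix (Fin N) (Fin N) ℂ) :=
  (p.1 (toCylinder p.2), fun i => partialDeriv p.1.mat i p.2)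

theorem tendsto_matrix_of_norm {α : Type*} {l : Filter α} {f : α → Matrix (Fin N) (Fin N) ℂ}
    {a : Matrix (Fin N) (Fin N) ℂ} (h : Tendsto (fun x => ‖f x - a‖) l (𝓝 0)) :
    Tendsto f l (𝓝 a) :=
  tendsto_iff_norm_sub_tendsto_zero.2 h

/-- Moving the family is controlled by the C⁰ and C¹ norms uniformly in the point; moving the point
uses only the limit family. -/
theorem continuous_jet : Continuous (jet (N := N)) := by
  rw [continuous_iff_continuousAt]
  rintro ⟨H, x⟩
  have hfst : Tendsto (Prod.fst : CylinderFamily N × slab → _) (𝓝 (H, x)) (𝓝 H) :=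
    continuous_fst.tendsto _
  have hsnd : Tendsto (Prod.snd : CylinderFamily N × slab → _) (𝓝 (H, x)) (𝓝 x) :=
    continuous_snd.tendsto _
  refine Tendsto.prodMk_nhds (tendsto_subtype_rng.2 ?_) (tendsto_pi_nhds.2 fun i => ?_)
  · refine tendsto_matrix_of_norm ?_
    have h := ((tendsto_ckNorm 0 H).comp hfst).add
      ((tendsto_norm_sub (F := Matrix (Fin N) (Fin N) ℂ) H.smooth x).comp hsnd)
    rw [add_zero] at h
    refine squeeze_zero (fun _ => norm_nonneg _) (fun p => ?_) h
    have h1 := le_ckNorm 0 p.1 H p.2 p.2.2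
    have h2 := norm_nonneg
      (iteratedFDerivWithin ℝ 0 (fun x => p.1.mat x - H.mat x) slab p.2)
    have h3 := norm_sub_le_norm_sub_add_norm_sub (p.1.mat p.2) (H.mat p.2) (H.mat x)
    change ‖p.1.mat p.2 - H.mat x‖ ≤
      ckNorm 0 (fun x => p.1.mat x - H.mat x) + ‖H.mat p.2 - H.mat x‖
    linarith
  · refine tendsto_matrix_of_norm ?_
    have h := ((tendsto_ckNorm 1 H).comp hfst).add
      ((tendsto_norm_partialDeriv_sub (F := Matrix (Fin N) (Fin N) ℂ) H.smooth i x).comp hsnd)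
    rw [add_zero] at h
    refine squeeze_zero (fun _ => norm_nonneg _) (fun p => ?_) h
    have h1 := le_ckNorm 1 p.1 H p.2 p.2.2
    have h2 := norm_nonneg (p.1.mat p.2 - H.mat p.2)
    have h3 := norm_sub_le_norm_sub_add_norm_sub (partialDeriv p.1.mat i p.2)
      (partialDeriv H.mat i p.2) (partialDeriv H.mat i x)
    have h4 := norm_partialDeriv_sub_le p.1.differentiableOn H.differentiableOn i p.2.2
    change ‖partialDeriv p.1.mat i p.2 - partialDeriv H.mat i x‖ ≤
      ckNorm 1 (fun x => p.1.mat x - H.mat x) + ‖partialDeriv H.mat i p.2 - partialDeriv H.mat i x‖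
    linarith

end Families

/-! ### Openness -/

section Openness

variable {N : ℕ}

theorem isClosed_exists_mem {X Y : Type*} [TopologicalSpace X] [TopologicalSpace Y] {K : Set Y}
    (hK : IsCompact K) {C : Set (X × Y)} (hC : IsClosed C) :
    IsClosed {x | ∃ y ∈ K, (x, y) ∈ C} := by
  have : CompactSpace K := isCompact_iff_compactSpace.1 hK
  have h1 : Continuous fun p : X × K => (p.1, (p.2 : Y)) := by fun_prop
  have h2 := isClosedMap_fst_of_compactSpace (X := X) (Y := K) _ (hC.preimage h1)
  convert h2 using 1
  ext x
  simp

theorem isCompact_frames (k : ℕ) : IsCompact {Q : Matrix (Fin N) (Fin k) ℂ | Qᴴ * Q = 1} := by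
  have hK : IsCompact (Set.univ.pi fun _ : Fin N => Set.univ.pi fun _ : Fin k =>
      Metric.closedBall (0 : ℂ) 1) :=
    isCompact_univ_pi fun _ => isCompact_univ_pi fun _ => isCompact_closedBall 0 1
  refine IsCompact.of_isClosed_subset hK (isClosed_eq (by fun_prop) continuous_const) ?_
  intro Q hQ i _ j _
  have h1 := congrArg Complex.re (congrFun (congrFun hQ j) j)
  simp only [mul_apply, conjTranspose_apply, RCLike.star_def, one_apply_eq, Complex.one_re,
    Complex.re_sum, Complex.conj_mul', ← Complex.ofReal_pow, Complex.ofReal_re] at h1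
  have h2 := Finset.single_le_sum (f := fun l => ‖Q l j‖ ^ 2) (fun l _ => by positivity)
    (Finset.mem_univ i)
  rw [h1] at h2
  rw [mem_closedBall_zero_iff]
  exact (sq_le_one_iff₀ (norm_nonneg _)).1 h2

theorem pauli_eq_zero_iff (M : Matrix (Fin 2) (Fin 2) ℂ) :
    pauli M = 0 ↔ (M 0 0).re = (M 1 1).re ∧ M 0 1 = 0 := by
  constructor
  · intro h
    have h0 := congrArg (fun z => z 0) h
    have h1 := congrArg (fun z => z 1) h
    have h2 := congrArg (fun z => z 2) h
    simp [pauli] at h0 h1 h2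
    exact ⟨by linarith, Complex.ext h1 h2⟩
  · rintro ⟨h1, h2⟩
    ext i
    fin_cases i <;> simp [pauli, h1, h2]

/-- The jets at which `λ_n` and `λ_{n+1}` cross in a degenerate way. -/
def degenerateJets (N n : ℕ) : Set (Herm N × (Fin 3 → Matrix (Fin N) (Fin N) ℂ)) :=
  {p | eigval p.1 n = eigval p.1 (n + 1) ∧ Degenerate (eigval p.1 n) p.1.1 p.2}

/-- Each alternative of `Degenerate` projects a closed set along a compact factor: frames, and in
the second case also the unit sphere of directions. This is why `Degenerate` quantifies over
orthonormal frames and unit vectors. -/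
theorem isClosed_degenerateJets (n : ℕ) : IsClosed (degenerateJets N n) := by
  have hev (j : ℕ) : Continuous fun A : Herm N => eigval A j := continuous_eigval j
  refine IsClosed.inter (isClosed_eq ((hev n).comp continuous_fst)
    ((hev (n + 1)).comp continuous_fst)) (IsClosed.union ?_ ?_)
  · refine isClosed_exists_mem (X := Herm N × (Fin 3 → Matrix (Fin N) (Fin N) ℂ))
      (isCompact_frames (N := N) 3) (C := {q | q.1.1.1 * q.2 = (eigval q.1.1 n : ℂ) • q.2}) (isClosed_eq ?_ ?_)
    · fun_prop
    · have := (hev n).comp (continuous_fst.comp continuous_fst :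
        Continuous fun q : (Herm N × (Fin 3 → Matrix (Fin N) (Fin N) ℂ)) ×
          Matrix (Fin N) (Fin 3) ℂ => q.1.1)
      exact (Complex.continuous_ofReal.comp this).smul continuous_snd
  · have h := isClosed_exists_mem (X := Herm N × (Fin 3 → Matrix (Fin N) (Fin N) ℂ))
      ((isCompact_frames (N := N) 2).prod (isCompact_sphere (0 : E3) 1))
      (C := {q | q.1.1.1 * q.2.1 = (eigval q.1.1 n : ℂ) • q.2.1 ∧
        pauli (q.2.1ᴴ * (∑ i, q.2.2 i • q.1.2 i) * q.2.1) = 0}) ?_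
    · refine (iff_of_eq (congrArg IsClosed (Set.ext fun p => ?_))).2 h
      constructor
      · rintro ⟨Q, ε, h1, h2, h3, h4⟩
        exact ⟨(Q, ε), ⟨h1, by simpa using h3⟩, h2, h4⟩
      · rintro ⟨⟨Q, ε⟩, ⟨h1, h3⟩, h2, h4⟩
        exact ⟨Q, ε, h1, h2, by simpa using h3, h4⟩
    · have hM : Continuous fun q : (Herm N × (Fin 3 → Matrix (Fin N) (Fin N) ℂ)) ×
          (Matrix (Fin N) (Fin 2) ℂ × E3) =>
          q.2.1ᴴ * (∑ i, q.2.2 i • q.1.2 i) * q.2.1 := by fun_prop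
      simp only [pauli_eq_zero_iff]
      refine IsClosed.inter (isClosed_eq ?_ ?_) (IsClosed.inter (isClosed_eq ?_ ?_)
        (isClosed_eq ?_ continuous_const))
      · fun_prop
      · have := (hev n).comp (continuous_fst.comp continuous_fst :
          Continuous fun q : (Herm N × (Fin 3 → Matrix (Fin N) (Fin N) ℂ)) ×
            (Matrix (Fin N) (Fin 2) ℂ × E3) => q.1.1)
        exact (Complex.continuous_ofReal.comp this).smul (continuous_fst.comp continuous_snd)
      · exact Complex.continuous_re.comp (hM.matrix_elem 0 0)
      · exact Complex.continuous_re.comp (hM.matrix_elem 1 1)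
      · exact hM.matrix_elem 0 1

theorem crosses_interior {H₀ H₁ : TorusFamily N} {n : ℕ}
    (hgap₀ : ∀ ξ : Torus, eigval (H₀ ξ) n < eigval (H₀ ξ) (n + 1))
    (hgap₁ : ∀ ξ : Torus, eigval (H₁ ξ) n < eigval (H₁ ξ) (n + 1))
    {H : CylinderFamily N} (hH : H ∈ homotopies H₀ H₁) {ζ : Cylinder} (hc : Crosses n H ζ) :
    0 < (ζ.1 : ℝ) ∧ (ζ.1 : ℝ) < 1 := by
  obtain ⟨⟨s, hs⟩, ξ⟩ := ζ
  refine ⟨hs.1.lt_of_ne' ?_, hs.2.lt_of_ne ?_⟩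
  · rintro rfl
    have h := hgap₀ ξ
    rw [← hH.1 ξ] at h
    exact h.ne hc
  · rintro rfl
    have h := hgap₁ ξ
    rw [← hH.2 ξ] at h
    exact h.ne hc

/-- Crossings are interior, where conical and nondegenerate agree. By periodicity it is enough to
test the points of norm at most 1 + 4π, a compact set. -/
theorem mem_conicalHomotopies_iff {H₀ H₁ : TorusFamily N} {n : ℕ} (hn : 1 ≤ n) (hnN : n + 1 ≤ N)
    (hgap₀ : ∀ ξ : Torus, eigval (H₀ ξ) n < eigval (H₀ ξ) (n + 1))
    (hgap₁ : ∀ ξ : Torus, eigval (H₁ ξ) n < eigval (H₁ ξ) (n + 1)) (H : homotopies H₀ H₁) :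
    H ∈ conicalHomotopies n H₀ H₁ ↔
      ∀ x : slab, ‖(x : E3)‖ ≤ 1 + 4 * Real.pi → jet (H.1, x) ∉ degenerateJets N n := by
  constructor
  · rintro h ⟨x, hx⟩ - ⟨hc, hd⟩
    obtain ⟨h0, h1⟩ := crosses_interior hgap₀ hgap₁ H.2 hc
    exact not_degenerate_of_crossesConically hn hnN (h _ hc) (admissible_mem_nhds h0 h1)
      (H.1.isLittleO hx) hd
  · intro h ζ hc
    obtain ⟨x, hx, hxn, rfl⟩ := exists_toCylinder_eq_norm_le ζ
    exact crossesConically_of_not_degenerate hn hnN hc (H.1.isLittleO hx)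
      fun hd => h ⟨x, hx⟩ hxn ⟨hc, hd⟩

theorem isClosed_slab : IsClosed slab := by
  rw [slab_eq_preimage]
  exact isClosed_Icc.preimage (EuclideanSpace.proj (0 : Fin 3) : E3 →L[ℝ] ℝ).continuous

theorem isCompact_slab_norm_le (r : ℝ) : IsCompact {x : slab | ‖(x : E3)‖ ≤ r} := by
  have h := isClosed_slab.isClosedEmbedding_subtypeVal.isCompact_preimage
    (isCompact_closedBall (0 : E3) r)
  convert h using 1
  ext x
  simp

theorem isOpen_conicalHomotopies {H₀ H₁ : TorusFamily N} {n : ℕ} (hn : 1 ≤ n) (hnN : n + 1 ≤ N)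
    (hgap₀ : ∀ ξ : Torus, eigval (H₀ ξ) n < eigval (H₀ ξ) (n + 1))
    (hgap₁ : ∀ ξ : Torus, eigval (H₁ ξ) n < eigval (H₁ ξ) (n + 1)) :
    IsOpen (conicalHomotopies n H₀ H₁) := by
  rw [isOpen_iff_eventually]
  intro H hH
  rw [mem_conicalHomotopies_iff hn hnN hgap₀ hgap₁] at hH
  simp only [mem_conicalHomotopies_iff hn hnN hgap₀ hgap₁]
  have hopen := ((isClosed_degenerateJets (N := N) n).preimage continuous_jet).isOpen_compl
  have hcont : Continuous fun p : homotopies H₀ H₁ × slab => (p.1.1, p.2) := by fun_prop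
  -- Tube lemma: an open condition on (H, x) that holds for all x in a compact set persists for
  -- nearby H.
  exact (isCompact_slab_norm_le (1 + 4 * Real.pi)).eventually_forall_of_forall_eventually
    fun x hx => (hopen.preimage hcont).mem_nhds (hH x hx)

end Openness

/-! ### Sard's theorem in equal dimensions -/

section Sard

variable {E F G K : Type*} [NormedAddCommGroup E] [NormedSpace ℝ E] [FiniteDimensional ℝ E]
  [NormedAddCommGroup F] [NormedSpace ℝ F] [NormedAddCommGroup G] [NormedSpace ℝ G]
  [NormedAddCommGroup K] [NormedSpace ℝ K]

/-- Differentiability between finite-dimensional spaces, with the derivative a plain linear map. -/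
def HasLinDeriv (f : E → F) (D : E →ₗ[ℝ] F) (x : E) : Prop :=
  HasFDerivAt f (LinearMap.toContinuousLinearMap D) x

theorem HasLinDeriv.linear (L : E →ₗ[ℝ] F) (x : E) : HasLinDeriv L L x :=
  (LinearMap.toContinuousLinearMap L).hasFDerivAt

theorem HasLinDeriv.const_add {f : E → F} {D : E →ₗ[ℝ] F} {x : E} (h : HasLinDeriv f D x) (c : F) :
    HasLinDeriv (fun y => c + f y) D x :=
  HasFDerivAt.const_add c h

theorem HasLinDeriv.add {f g : E → F} {D D' : E →ₗ[ℝ] F} {x : E} (h : HasLinDeriv f D x)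
    (h' : HasLinDeriv g D' x) : HasLinDeriv (fun y => f y + g y) (D + D') x := by
  have := HasFDerivAt.fun_add h h'
  rwa [← map_add] at this

theorem HasLinDeriv.sub {f g : E → F} {D D' : E →ₗ[ℝ] F} {x : E} (h : HasLinDeriv f D x)
    (h' : HasLinDeriv g D' x) : HasLinDeriv (fun y => f y - g y) (D - D') x := by
  have := HasFDerivAt.fun_sub h h'
  rwa [← map_sub] at this

variable [FiniteDimensional ℝ F]

theorem HasLinDeriv.comp {g : F → G} {D' : F →ₗ[ℝ] G} {f : E → F} {D : E →ₗ[ℝ] F} {x : E}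
    (h' : HasLinDeriv g D' (f x)) (h : HasLinDeriv f D x) :
    HasLinDeriv (fun y => g (f y)) (D'.comp D) x :=
  HasFDerivAt.comp x h' h

theorem HasLinDeriv.bilinear [FiniteDimensional ℝ G] (b : F →ₗ[ℝ] G →ₗ[ℝ] K) {f : E → F} {D : E →ₗ[ℝ] F} {g : E → G}
    {D' : E →ₗ[ℝ] G} {x : E} (h : HasLinDeriv f D x) (h' : HasLinDeriv g D' x) :
    HasLinDeriv (fun y => b (f y) (g y)) ((b (f x)).comp D' + (b.flip (g x)).comp D) x := by
  let β : F →L[ℝ] G →L[ℝ] K := LinearMap.toContinuousLinearMap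
    ((LinearMap.toContinuousLinearMap : (G →ₗ[ℝ] K) ≃ₗ[ℝ] (G →L[ℝ] K)).toLinearMap.comp b)
  have h3 := β.hasFDerivAt_of_bilinear h h'
  exact h3

theorem det_eq_zero_of_apply_eq_zero (f : F →ₗ[ℝ] F) {v : F} (hv : v ≠ 0) (h : f v = 0) :
    LinearMap.det f = 0 := by
  by_contra hne
  have h1 : LinearMap.equivOfDetNeZero f hne v = 0 := h
  exact hv ((LinearEquiv.map_eq_zero_iff _).1 h1)

/-- Sard's theorem between spaces of equal dimension, for countably many maps. -/
theorem exists_norm_lt_notMem_critical {ι : Type*} [Countable ι]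
    (hd : Module.finrank ℝ E = Module.finrank ℝ F) (f : ι → E → F) (s : ι → Set E)
    (h : ∀ i, ∀ x ∈ s i, ∃ D : E →ₗ[ℝ] F, HasLinDeriv (f i) D x ∧ ∃ v ≠ 0, D v = 0)
    {δ : ℝ} (hδ : 0 < δ) : ∃ y : F, ‖y‖ < δ ∧ ∀ i, y ∉ f i '' s i := by
  let : MeasurableSpace F := borel F
  have : BorelSpace F := ⟨rfl⟩
  let μ : MeasureTheory.Measure F := MeasureTheory.Measure.addHaar
  -- Identifying the source with F gives the derivative a determinant; critical values then have
  -- measure zero under mere differentiability.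
  let κ : F ≃L[ℝ] E := ContinuousLinearEquiv.ofFinrankEq hd.symm
  have h0 : ∀ i, μ (f i '' s i) = 0 := fun i => by
    have hD : ∀ x : F, ∃ D : F →L[ℝ] F, κ x ∈ s i →
        HasFDerivAt (f i ∘ κ) D x ∧ D.det = 0 := fun x => by
      by_cases hx : κ x ∈ s i
      · obtain ⟨D, hD, v, hv, hDv⟩ := h i _ hx
        refine ⟨(LinearMap.toContinuousLinearMap D).comp (κ : F →L[ℝ] E), fun _ =>
          ⟨HasFDerivAt.comp x hD κ.hasFDerivAt, ?_⟩⟩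
        refine det_eq_zero_of_apply_eq_zero _ (v := κ.symm v) ?_ ?_
        · simpa using hv
        · simpa using hDv
      · exact ⟨0, fun hx' => absurd hx' hx⟩
    choose D hD using hD
    have h1 := MeasureTheory.addHaar_image_eq_zero_of_det_fderivWithin_eq_zero μ
      (s := κ ⁻¹' s i) (f := f i ∘ κ) (f' := D) (fun x hx => (hD x hx).1.hasFDerivWithinAt)
      fun x hx => (hD x hx).2
    rwa [Set.image_comp, Set.image_preimage_eq _ κ.surjective] at h1
  have h1 : ∀ᵐ y ∂μ, ∀ i, y ∉ f i '' s i :=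
    MeasureTheory.ae_all_iff.2 fun i => MeasureTheory.measure_eq_zero_iff_ae_notMem.1 (h0 i)
  obtain ⟨y, hy, hy'⟩ := (MeasureTheory.Measure.dense_of_ae h1).exists_dist_lt 0 hδ
  exact ⟨y, by simpa using hy', hy⟩

end Sard

/-! ### Hermitian matrices as a real vector space of dimension N² -/

section RealCoordinates

variable {k : Type*}

/-- The Hermitian matrix whose real coordinates are the entries of a real matrix. -/
noncomputable def ofRealMatrix : Matrix k k ℝ →ₗ[ℝ] Matrix k k ℂ where
  toFun R := Matrix.of fun i j => ⟨(R i j + R j i) / 2, (R i j - R j i) / 2⟩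
  map_add' R S := by
    ext i j
    apply Complex.ext <;> simp <;> ring
  map_smul' c R := by
    ext i j
    apply Complex.ext <;> simp <;> ring

/-- The sum of the real and the imaginary parts of the entries. -/
def toRealMatrix : Matrix k k ℂ →ₗ[ℝ] Matrix k k ℝ where
  toFun M := Matrix.of fun i j => (M i j).re + (M i j).im
  map_add' M M' := by
    ext i j
    simp
    ring
  map_smul' c M := by
    ext i j
    simp
    ring

theorem isHermitian_ofRealMatrix (R : Matrix k k ℝ) : (ofRealMatrix R).IsHermitian := by
  ext i j
  apply Complex.ext <;> simp [ofRealMatrix] <;> ring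

/-- The symmetric part of R is stored as real part and the antisymmetric part as imaginary part;
their sum gives R back. -/
theorem toRealMatrix_ofRealMatrix (R : Matrix k k ℝ) : toRealMatrix (ofRealMatrix R) = R := by
  ext i j
  simp [ofRealMatrix, toRealMatrix]
  ring

theorem ofRealMatrix_toRealMatrix {M : Matrix k k ℂ} (hM : M.IsHermitian) :
    ofRealMatrix (toRealMatrix M) = M := by
  ext i j
  have h := hM.apply i j
  have h1 := congrArg Complex.re h
  have h2 := congrArg Complex.im h
  simp at h1 h2
  apply Complex.ext <;> simp [ofRealMatrix, toRealMatrix] <;> linarith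

theorem eq_of_toRealMatrix_eq {M M' : Matrix k k ℂ} (hM : M.IsHermitian) (hM' : M'.IsHermitian)
    (h : toRealMatrix M = toRealMatrix M') : M = M' := by
  rw [← ofRealMatrix_toRealMatrix hM, h, ofRealMatrix_toRealMatrix hM']

end RealCoordinates

/-! ### Graph charts for planes of eigenvectors -/

section Chart

variable {m : ℕ}

/-- The splitting `ℂ^(m+2) = ℂ² ⊕ ℂ^m` given by a bijection of the coordinates: the inclusion of
the first summand. -/
def inclLeft (e : Fin 2 ⊕ Fin m ≃ Fin (m + 2)) : Matrix (Fin (m + 2)) (Fin 2) ℂ :=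
  (1 : Matrix (Fin (m + 2)) (Fin (m + 2)) ℂ).submatrix id fun j => e (Sum.inl j)

/-- The inclusion of the second summand. -/
def inclRight (e : Fin 2 ⊕ Fin m ≃ Fin (m + 2)) : Matrix (Fin (m + 2)) (Fin m) ℂ :=
  (1 : Matrix (Fin (m + 2)) (Fin (m + 2)) ℂ).submatrix id fun j => e (Sum.inr j)

variable (e : Fin 2 ⊕ Fin m ≃ Fin (m + 2))

theorem inclLeft_conjTranspose_mul {k : Type*} (M : Matrix (Fin (m + 2)) k ℂ) :
    (inclLeft e)ᴴ * M = M.submatrix (fun j => e (Sum.inl j)) id := by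
  rw [inclLeft, conjTranspose_submatrix, conjTranspose_one]
  ext i j
  simp [mul_apply, one_apply]

theorem inclRight_conjTranspose_mul {k : Type*} (M : Matrix (Fin (m + 2)) k ℂ) :
    (inclRight e)ᴴ * M = M.submatrix (fun j => e (Sum.inr j)) id := by
  rw [inclRight, conjTranspose_submatrix, conjTranspose_one]
  ext i j
  simp [mul_apply, one_apply]

theorem inclLeft_mul_inclLeft : (inclLeft e)ᴴ * inclLeft e = 1 := by
  rw [inclLeft_conjTranspose_mul]
  ext i j
  simp [inclLeft, one_apply]

theorem inclRight_mul_inclRight : (inclRight e)ᴴ * inclRight e = 1 := by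
  rw [inclRight_conjTranspose_mul]
  ext i j
  simp [inclRight, one_apply]

theorem inclLeft_mul_inclRight : (inclLeft e)ᴴ * inclRight e = 0 := by
  rw [inclLeft_conjTranspose_mul]
  ext i j
  simp [inclRight, one_apply]

theorem inclRight_mul_inclLeft : (inclRight e)ᴴ * inclLeft e = 0 := by
  rw [inclRight_conjTranspose_mul]
  ext i j
  simp [inclLeft, one_apply]

theorem incl_mul_conjTranspose_add :
    inclLeft e * (inclLeft e)ᴴ + inclRight e * (inclRight e)ᴴ = 1 := by
  ext i j
  obtain ⟨i, rfl⟩ := e.surjective i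
  obtain ⟨j, rfl⟩ := e.surjective j
  rcases i with i | i <;> rcases j with j | j <;>
    simp [inclLeft, inclRight, mul_apply, one_apply]

/-- A matrix whose columns span the graph of `X`. -/
noncomputable def graphFrame (X : Matrix (Fin m) (Fin 2) ℂ) : Matrix (Fin (m + 2)) (Fin 2) ℂ :=
  inclLeft e + inclRight e * X

/-- A matrix whose columns span the orthogonal complement of the graph of `X`. -/
noncomputable def coFrame (X : Matrix (Fin m) (Fin 2) ℂ) : Matrix (Fin (m + 2)) (Fin m) ℂ :=
  inclRight e - inclLeft e * Xᴴ

theorem coFrame_conjTranspose (X : Matrix (Fin m) (Fin 2) ℂ) :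
    (coFrame e X)ᴴ = (inclRight e)ᴴ - X * (inclLeft e)ᴴ := by
  simp [coFrame]

theorem coFrame_mul_graphFrame (X : Matrix (Fin m) (Fin 2) ℂ) :
    (coFrame e X)ᴴ * graphFrame e X = 0 := by
  rw [coFrame_conjTranspose, graphFrame, Matrix.sub_mul, Matrix.mul_add, Matrix.mul_add,
    ← Matrix.mul_assoc, inclRight_mul_inclRight, inclRight_mul_inclLeft, Matrix.mul_assoc,
    inclLeft_mul_inclLeft, Matrix.mul_assoc, ← Matrix.mul_assoc (inclLeft e)ᴴ,
    inclLeft_mul_inclRight]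
  simp

theorem graphFrame_mul_coFrame (X : Matrix (Fin m) (Fin 2) ℂ) :
    (graphFrame e X)ᴴ * coFrame e X = 0 := by
  have h := congrArg conjTranspose (coFrame_mul_graphFrame e X)
  simpa using h

theorem inclRight_mul_coFrame (X : Matrix (Fin m) (Fin 2) ℂ) :
    (inclRight e)ᴴ * coFrame e X = 1 := by
  rw [coFrame, Matrix.mul_sub, inclRight_mul_inclRight, ← Matrix.mul_assoc,
    inclRight_mul_inclLeft]
  simp

theorem inclLeft_mul_graphFrame (X : Matrix (Fin m) (Fin 2) ℂ) :
    (inclLeft e)ᴴ * graphFrame e X = 1 := by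
  rw [graphFrame, Matrix.mul_add, inclLeft_mul_inclLeft, ← Matrix.mul_assoc,
    inclLeft_mul_inclRight]
  simp

theorem graphFrame_mul_inclLeft (X : Matrix (Fin m) (Fin 2) ℂ) :
    (graphFrame e X)ᴴ * inclLeft e = 1 := by
  have h := congrArg conjTranspose (inclLeft_mul_graphFrame e X)
  simpa using h

/-- A Hermitian matrix that kills the graph of `X` is determined by its lower block. -/
theorem eq_coFrame_mul {T : Matrix (Fin (m + 2)) (Fin (m + 2)) ℂ} (hT : T.IsHermitian)
    {X : Matrix (Fin m) (Fin 2) ℂ} (h : T * graphFrame e X = 0) :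
    T = coFrame e X * ((inclRight e)ᴴ * T * inclRight e) * (coFrame e X)ᴴ := by
  -- Killing the graph expresses the first block of columns of T through the second. Hermitian
  -- symmetry then does the same for rows.
  have h1 : T * inclRight e * (coFrame e X)ᴴ = T := by
    rw [graphFrame, Matrix.mul_add, ← Matrix.mul_assoc] at h
    have h2 : T * inclRight e * X = -(T * inclLeft e) := by
      rw [eq_neg_iff_add_eq_zero, add_comm (T * _ * X), h]
    rw [coFrame_conjTranspose, Matrix.mul_sub, ← Matrix.mul_assoc _ X, h2, Matrix.neg_mul,
      sub_neg_eq_add, Matrix.mul_assoc, Matrix.mul_assoc, ← Matrix.mul_add, add_comm (inclRight e * _),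
      incl_mul_conjTranspose_add, Matrix.mul_one]
  have h2 : coFrame e X * ((inclRight e)ᴴ * T) = T := by
    have h3 := congrArg conjTranspose h1
    simp only [conjTranspose_mul, conjTranspose_conjTranspose, hT.eq] at h3
    exact h3
  rw [Matrix.mul_assoc, Matrix.mul_assoc ((inclRight e)ᴴ * T), ← Matrix.mul_assoc (coFrame e X), h2,
    ← Matrix.mul_assoc, h1]

/-- Some 2 × 2 minor of Q is nonzero, for otherwise the second column would be a multiple of the
first, against orthonormality. Over those two coordinates the plane is a graph. Only finitely many
bijections e exist, so finitely many charts suffice. -/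
theorem exists_chart {Q : Matrix (Fin (m + 2)) (Fin 2) ℂ} (hQ : Qᴴ * Q = 1) :
    ∃ (e : Fin 2 ⊕ Fin m ≃ Fin (m + 2)) (X : Matrix (Fin m) (Fin 2) ℂ)
      (S : Matrix (Fin 2) (Fin 2) ℂ), graphFrame e X = Q * S := by
  have hQ' : ∀ i j, ∑ l, star (Q l i) * Q l j = (1 : Matrix (Fin 2) (Fin 2) ℂ) i j := fun i j => by
    rw [← hQ, mul_apply]
    rfl
  obtain ⟨a, ha⟩ : ∃ a, Q a 0 ≠ 0 := by
    by_contra! h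
    have := hQ' 0 0
    simp [h] at this
  obtain ⟨b, hb⟩ : ∃ b, Q a 0 * Q b 1 - Q a 1 * Q b 0 ≠ 0 := by
    by_contra! h
    obtain ⟨r, h1⟩ : ∃ r, ∀ l, Q l 1 = r * Q l 0 := ⟨Q a 1 / Q a 0, fun l => by
      rw [div_mul_eq_mul_div, eq_div_iff ha]
      linear_combination h l⟩
    have h01 := hQ' 0 1
    have h00 := hQ' 0 0
    have h11 := hQ' 1 1
    simp only [h1, mul_left_comm _ r, ← Finset.mul_sum] at h01
    rw [h00] at h01
    have hz : r = 0 := by simpa using h01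
    simp [h1, hz] at h11
  have hab : a ≠ b := by
    rintro rfl
    apply hb
    ring
  obtain ⟨e, he0, he1⟩ : ∃ e : Fin 2 ⊕ Fin m ≃ Fin (m + 2),
      e (Sum.inl 0) = a ∧ e (Sum.inl 1) = b := by
    let e₀ : Fin 2 ⊕ Fin m ≃ Fin (m + 2) := finSumFinEquiv.trans (finCongr (add_comm 2 m))
    let e₁ := e₀.trans (Equiv.swap (e₀ (Sum.inl 0)) a)
    have h0 : e₁ (Sum.inl 0) = a := (Equiv.trans_apply _ _ _).trans (Equiv.swap_apply_left _ _)
    refine ⟨e₁.trans (Equiv.swap (e₁ (Sum.inl 1)) b), ?_,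
      (Equiv.trans_apply _ _ _).trans (Equiv.swap_apply_left _ _)⟩
    rw [Equiv.trans_apply, h0]
    refine Equiv.swap_apply_of_ne_of_ne ?_ hab
    rw [← h0]
    exact e₁.injective.ne (by simp)
  have hdet : IsUnit ((inclLeft e)ᴴ * Q).det := by
    rw [inclLeft_conjTranspose_mul, det_fin_two]
    simpa [he0, he1] using hb
  refine ⟨e, (inclRight e)ᴴ * (Q * ((inclLeft e)ᴴ * Q)⁻¹), ((inclLeft e)ᴴ * Q)⁻¹, ?_⟩
  have h1 : (inclLeft e)ᴴ * (Q * ((inclLeft e)ᴴ * Q)⁻¹) = 1 := by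
    rw [← Matrix.mul_assoc, mul_nonsing_inv _ hdet]
  have h2 := congrArg (· * (Q * ((inclLeft e)ᴴ * Q)⁻¹)) (incl_mul_conjTranspose_add e)
  simp only [Matrix.add_mul, Matrix.one_mul] at h2
  rw [Matrix.mul_assoc, h1, Matrix.mul_one, Matrix.mul_assoc] at h2
  exact h2

end Chart

/-! ### Transversality by generic constant perturbation -/

section ParametricSard

variable {m : ℕ}

/-- Matrix multiplication as a real bilinear map. -/
noncomputable def mulBilin (a b c : Type*) [Fintype b] :
    Matrix a b ℂ →ₗ[ℝ] Matrix b c ℂ →ₗ[ℝ] Matrix a c ℂ :=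
  LinearMap.mk₂ ℝ (fun M M' => M * M') Matrix.add_mul (fun r M M' => Matrix.smul_mul r M M')
    Matrix.mul_add fun r M M' => Matrix.mul_smul M r M'

/-- The conjugate transpose as a real linear map. -/
def conjTransposeReal (a b : Type*) : Matrix a b ℂ →ₗ[ℝ] Matrix b a ℂ where
  toFun M := Mᴴ
  map_add' := conjTranspose_add
  map_smul' r M := by simp [conjTranspose_smul]

/-- Coordinates on the Hermitian matrices with an at least double eigenvalue, together with a point
of `ℝ³`. -/
abbrev ChartSpace (m : ℕ) : Type :=
  ℝ × Matrix (Fin m) (Fin 2) ℂ × Matrix (Fin m) (Fin m) ℝ × E3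

/-- The count 1 + 4m + m² + 3 = (m + 2)²: codimension three is compensated exactly by the three
parameters. -/
theorem finrank_chartSpace (m : ℕ) : Module.finrank ℝ (ChartSpace m) =
    Module.finrank ℝ (Matrix (Fin (m + 2)) (Fin (m + 2)) ℝ) := by
  simp only [ChartSpace, Module.finrank_prod, Module.finrank_matrix, Module.finrank_self,
    Fintype.card_fin, Complex.finrank_real_complex, finrank_euclideanSpace_fin]
  ring

/-- The Hermitian matrix with eigenvalue `c` on the graph of `X` and lower block `c + C`. -/
noncomputable def doubleMatrix (e : Fin 2 ⊕ Fin m ≃ Fin (m + 2)) (p : ChartSpace m) :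
    Matrix (Fin (m + 2)) (Fin (m + 2)) ℂ :=
  p.1 • 1 + coFrame e p.2.1 * ofRealMatrix p.2.2.1 * (coFrame e p.2.1)ᴴ

/-- The derivative of `doubleMatrix`. -/
noncomputable def doubleMatrixDeriv (e : Fin 2 ⊕ Fin m ≃ Fin (m + 2)) (p v : ChartSpace m) :
    Matrix (Fin (m + 2)) (Fin (m + 2)) ℂ :=
  v.1 • 1 + (coFrame e p.2.1 * ofRealMatrix p.2.2.1 * -(v.2.1 * (inclLeft e)ᴴ) +
    (coFrame e p.2.1 * ofRealMatrix v.2.2.1 + -(inclLeft e * v.2.1ᴴ) * ofRealMatrix p.2.2.1) *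
      (coFrame e p.2.1)ᴴ)

theorem isHermitian_doubleMatrixDeriv (e : Fin 2 ⊕ Fin m ≃ Fin (m + 2)) (p v : ChartSpace m) :
    (doubleMatrixDeriv e p v).IsHermitian := by
  rw [IsHermitian, doubleMatrixDeriv]
  simp only [conjTranspose_add, conjTranspose_mul, conjTranspose_neg, conjTranspose_conjTranspose,
    conjTranspose_smul, conjTranspose_one, (isHermitian_ofRealMatrix p.2.2.1).eq,
    (isHermitian_ofRealMatrix v.2.2.1).eq, Matrix.add_mul, Matrix.mul_neg,
    Matrix.neg_mul, Matrix.mul_assoc]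
  simp only [star_trivial]
  abel

theorem hasLinDeriv_doubleMatrix (e : Fin 2 ⊕ Fin m ≃ Fin (m + 2)) (p : ChartSpace m) :
    ∃ D, HasLinDeriv (doubleMatrix e) D p ∧ ∀ v, D v = doubleMatrixDeriv e p v := by
  let π₁ : ChartSpace m →ₗ[ℝ] ℝ := LinearMap.fst ℝ _ _
  let πX : ChartSpace m →ₗ[ℝ] Matrix (Fin m) (Fin 2) ℂ :=
    (LinearMap.fst ℝ _ _).comp (LinearMap.snd ℝ _ _)
  let πC : ChartSpace m →ₗ[ℝ] Matrix (Fin m) (Fin m) ℝ :=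
    (LinearMap.fst ℝ _ _).comp ((LinearMap.snd ℝ _ _).comp (LinearMap.snd ℝ _ _))
  let L₁ : ChartSpace m →ₗ[ℝ] Matrix (Fin (m + 2)) (Fin (m + 2)) ℂ := π₁.smulRight 1
  let LW : ChartSpace m →ₗ[ℝ] Matrix (Fin (m + 2)) (Fin m) ℂ :=
    -((mulBilin _ _ _ (inclLeft e)).comp ((conjTransposeReal _ _).comp πX))
  let LW' : ChartSpace m →ₗ[ℝ] Matrix (Fin m) (Fin (m + 2)) ℂ :=
    -(((mulBilin _ _ _).flip (inclLeft e)ᴴ).comp πX)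
  have hW : HasLinDeriv (fun q : ChartSpace m => inclRight e + LW q) LW p :=
    (HasLinDeriv.linear LW p).const_add _
  have hW' : HasLinDeriv (fun q : ChartSpace m => (inclRight e)ᴴ + LW' q) LW' p :=
    (HasLinDeriv.linear LW' p).const_add _
  have hC := HasLinDeriv.linear (ofRealMatrix.comp πC) p
  have h := (HasLinDeriv.linear L₁ p).add
    (((hW.bilinear (mulBilin _ _ _) hC)).bilinear (mulBilin _ _ _) hW')
  have ef : (fun q : ChartSpace m => L₁ q + mulBilin _ _ _ (mulBilin _ _ _ (inclRight e + LW q)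
      ((ofRealMatrix.comp πC) q)) ((inclRight e)ᴴ + LW' q)) = doubleMatrix e := by
    funext q
    rw [doubleMatrix, coFrame_conjTranspose, coFrame, sub_eq_add_neg, sub_eq_add_neg]
    rfl
  rw [ef] at h
  refine ⟨_, h, fun v => ?_⟩
  rw [doubleMatrixDeriv, coFrame_conjTranspose, coFrame, sub_eq_add_neg, sub_eq_add_neg]
  rfl

/-- Every term of the derivative except the one in c begins with the coframe or ends with its
adjoint, and both vanish against the graph. To first order, compression to the plane sees only the
motion of c. -/
theorem graphFrame_doubleMatrixDeriv (e : Fin 2 ⊕ Fin m ≃ Fin (m + 2)) (p v : ChartSpace m) :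
    (graphFrame e p.2.1)ᴴ * doubleMatrixDeriv e p v * graphFrame e p.2.1 =
      v.1 • ((graphFrame e p.2.1)ᴴ * graphFrame e p.2.1) := by
  have h1 := coFrame_mul_graphFrame e p.2.1
  have h2 := graphFrame_mul_coFrame e p.2.1
  have h3 : ∀ {k : Type} (M : Matrix (Fin m) k ℂ),
      (graphFrame e p.2.1)ᴴ * (coFrame e p.2.1 * M) = 0 := fun M => by
    rw [← Matrix.mul_assoc, h2, Matrix.zero_mul]
  simp only [doubleMatrixDeriv, Matrix.mul_add, Matrix.add_mul, Matrix.mul_assoc, h1, h3,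
    Matrix.mul_zero, Matrix.zero_mul, Matrix.mul_smul, Matrix.smul_mul, Matrix.mul_one,
    add_zero]

/-- If C kills X, the eigenspace of c is larger than the graph, and tilting the plane inside it
leaves the matrix fixed to first order. -/
theorem doubleMatrixDeriv_eq_zero (e : Fin 2 ⊕ Fin m ≃ Fin (m + 2)) (p : ChartSpace m)
    {X : Matrix (Fin m) (Fin 2) ℂ} (hX : ofRealMatrix p.2.2.1 * X = 0) :
    doubleMatrixDeriv e p (0, X, 0, 0) = 0 := by
  have h := congrArg conjTranspose hX
  rw [conjTranspose_mul, (isHermitian_ofRealMatrix p.2.2.1).eq, conjTranspose_zero] at h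
  simp only [doubleMatrixDeriv, map_zero, Matrix.mul_zero, Matrix.neg_mul, Matrix.mul_neg,
    Matrix.mul_assoc, zero_smul, zero_add]
  rw [← Matrix.mul_assoc _ X, hX, ← Matrix.mul_assoc _ (ofRealMatrix p.2.2.1), h]
  simp

theorem compression_eq_of_pauli_eq_zero {N : ℕ} {Q : Matrix (Fin N) (Fin 2) ℂ}
    {M : Matrix (Fin N) (Fin N) ℂ} (hM : M.IsHermitian) (h : pauliCompression Q M = 0) :
    ∃ a : ℝ, Qᴴ * M * Q = a • 1 := by
  have hH : (Qᴴ * M * Q).IsHermitian := isHermitian_conjTranspose_mul_mul Q hM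
  obtain ⟨h1, h2⟩ := (pauli_eq_zero_iff _).1 h
  have h10 : (Qᴴ * M * Q) 1 0 = star ((Qᴴ * M * Q) 0 1) := (hH.apply 1 0).symm
  have h00 : ((Qᴴ * M * Q) 0 0).im = 0 := Complex.conj_eq_iff_im.1 (hH.apply 0 0)
  have h11 : ((Qᴴ * M * Q) 1 1).im = 0 := Complex.conj_eq_iff_im.1 (hH.apply 1 1)
  refine ⟨((Qᴴ * M * Q) 0 0).re, ?_⟩
  ext i j
  fin_cases i <;> fin_cases j
  · apply Complex.ext <;> simp [h00]
  · simp [h2]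
  · simp [h10, h2]
  · apply Complex.ext <;> simp [h11, h1]

/-- If the first-order splitting vanishes in some direction, the chart map is critical. -/
theorem exists_ne_zero_of_compression (e : Fin 2 ⊕ Fin m ≃ Fin (m + 2)) (p : ChartSpace m)
    {B : Fin 3 → Matrix (Fin (m + 2)) (Fin (m + 2)) ℂ} (hB : ∀ ε, (jetMap B ε).IsHermitian)
    {ε : E3} (hε : ε ≠ 0) {a : ℝ}
    (ha : (graphFrame e p.2.1)ᴴ * jetMap B ε * graphFrame e p.2.1 =
      a • ((graphFrame e p.2.1)ᴴ * graphFrame e p.2.1))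
    {D : ChartSpace m →ₗ[ℝ] Matrix (Fin (m + 2)) (Fin (m + 2)) ℝ}
    (hD : ∀ v, D v = toRealMatrix (doubleMatrixDeriv e p v - jetMap B v.2.2.2)) :
    ∃ v ≠ 0, D v = 0 := by
  by_contra! hinj
  have hinj' : Function.Injective D := by
    rw [← LinearMap.ker_eq_bot, LinearMap.ker_eq_bot']
    intro v hv
    by_contra h0
    exact hinj v h0 hv
  have hsurj : Function.Surjective D :=
    (LinearMap.injective_iff_surjective_of_finrank_eq_finrank (finrank_chartSpace m)).1 hinj'
  set Z := graphFrame e p.2.1 with hZ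
  -- Compression of D to the plane, a map between spaces of dimension four. If D were injective it
  -- would be onto by dimension, so τ would be onto and hence injective, although (a, ε) is in its
  -- kernel.
  let τ : ℝ × E3 →ₗ[ℝ] Matrix (Fin 2) (Fin 2) ℝ :=
    { toFun := fun q => toRealMatrix (q.1 • (Zᴴ * Z) - Zᴴ * jetMap B q.2 * Z)
      map_add' := fun q q' => by
        rw [← map_add]
        congr 1
        simp only [Prod.fst_add, Prod.snd_add, map_add, add_smul, Matrix.mul_add, Matrix.add_mul]
        abel
      map_smul' := fun r q => by
        rw [RingHom.id_apply, ← map_smul]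
        congr 1
        simp only [Prod.smul_fst, Prod.smul_snd, map_smul, smul_sub, Matrix.mul_smul,
          Matrix.smul_mul, smul_eq_mul, mul_smul] }
  have hτ : Function.Surjective τ := fun R => by
    -- A Hermitian matrix whose compression by the graph frame is the prescribed 2 × 2 one, since
    -- that frame has identity first block.
    have hM : (inclLeft e * ofRealMatrix R * (inclLeft e)ᴴ).IsHermitian :=
      isHermitian_mul_mul_conjTranspose _ (isHermitian_ofRealMatrix R)
    obtain ⟨v, hv⟩ := hsurj (toRealMatrix (inclLeft e * ofRealMatrix R * (inclLeft e)ᴴ))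
    rw [hD] at hv
    have h1 := eq_of_toRealMatrix_eq ((isHermitian_doubleMatrixDeriv e p v).sub (hB _)) hM hv
    refine ⟨(v.1, v.2.2.2), ?_⟩
    have h2 := congrArg (fun M => Zᴴ * M * Z) h1
    simp only [Matrix.mul_sub, Matrix.sub_mul] at h2
    rw [hZ, graphFrame_doubleMatrixDeriv, Matrix.mul_assoc (inclLeft e), ← Matrix.mul_assoc _ᴴ,
      graphFrame_mul_inclLeft, Matrix.one_mul, Matrix.mul_assoc (ofRealMatrix R),
      inclLeft_mul_graphFrame, Matrix.mul_one] at h2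
    change toRealMatrix (v.1 • (Zᴴ * Z) - Zᴴ * jetMap B v.2.2.2 * Z) = R
    rw [hZ, h2, toRealMatrix_ofRealMatrix]
  have hfin : Module.finrank ℝ (ℝ × E3) = Module.finrank ℝ (Matrix (Fin 2) (Fin 2) ℝ) := by
    simp [Module.finrank_prod, Module.finrank_matrix]
  have hτ' := (LinearMap.injective_iff_surjective_of_finrank_eq_finrank hfin).2 hτ
  have h0 : τ (a, ε) = τ 0 := by
    rw [map_zero]
    change toRealMatrix (a • (Zᴴ * Z) - Zᴴ * jetMap B ε * Z) = 0
    rw [ha, sub_self, map_zero]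
  exact hε (congrArg Prod.snd (hτ' h0))

theorem exists_doubleMatrix_eq {M : Matrix (Fin (m + 2)) (Fin (m + 2)) ℂ} (hM : M.IsHermitian)
    {c : ℝ} {Q : Matrix (Fin (m + 2)) (Fin 2) ℂ} (hQ : Qᴴ * Q = 1)
    (hMQ : M * Q = (c : ℂ) • Q) :
    ∃ (e : Fin 2 ⊕ Fin m ≃ Fin (m + 2)) (X : Matrix (Fin m) (Fin 2) ℂ)
      (R : Matrix (Fin m) (Fin m) ℝ) (S : Matrix (Fin 2) (Fin 2) ℂ), graphFrame e X = Q * S ∧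
      ∀ x, doubleMatrix e (c, X, R, x) = M := by
  obtain ⟨e, X, S, hS⟩ := exists_chart hQ
  have hT : (M - c • 1).IsHermitian := hM.sub (by simp [IsHermitian, conjTranspose_smul])
  have hTZ : (M - c • 1) * graphFrame e X = 0 := by
    rw [hS, ← Matrix.mul_assoc, Matrix.sub_mul, hMQ, Matrix.smul_mul, Matrix.one_mul,
      Complex.coe_smul, sub_self, Matrix.zero_mul]
  have hR : ofRealMatrix (toRealMatrix ((inclRight e)ᴴ * (M - c • 1) * inclRight e)) =
      (inclRight e)ᴴ * (M - c • 1) * inclRight e :=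
    ofRealMatrix_toRealMatrix (isHermitian_conjTranspose_mul_mul _ hT)
  refine ⟨e, X, toRealMatrix ((inclRight e)ᴴ * (M - c • 1) * inclRight e), S, hS, fun x => ?_⟩
  rw [doubleMatrix, hR, ← eq_coFrame_mul e hT hTZ]
  simp

/-- Three independent eigenvectors cannot all lie in the plane of the graph, so some column of the
adjoint coframe applied to Q is nonzero. C kills that column; repeating it twice gives X'. -/
theorem exists_mul_eq_zero_of_triple {M : Matrix (Fin (m + 2)) (Fin (m + 2)) ℂ} {c : ℝ}
    {Q : Matrix (Fin (m + 2)) (Fin 3) ℂ} (hQ : Qᴴ * Q = 1) (hMQ : M * Q = (c : ℂ) • Q)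
    (e : Fin 2 ⊕ Fin m ≃ Fin (m + 2)) (X : Matrix (Fin m) (Fin 2) ℂ)
    {C : Matrix (Fin m) (Fin m) ℂ}
    (hC : M = c • 1 + coFrame e X * C * (coFrame e X)ᴴ) :
    ∃ X' : Matrix (Fin m) (Fin 2) ℂ, X' ≠ 0 ∧ C * X' = 0 := by
  have hCY : C * ((coFrame e X)ᴴ * Q) = 0 := by
    have h1 := hMQ
    rw [hC, Matrix.add_mul, Matrix.smul_mul, Matrix.one_mul, Complex.coe_smul,
      add_eq_left] at h1
    have h2 := congrArg (fun T => (inclRight e)ᴴ * T) h1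
    simp only [← Matrix.mul_assoc, inclRight_mul_coFrame, Matrix.one_mul, Matrix.mul_zero] at h2
    rw [← Matrix.mul_assoc]
    exact h2
  have hY : (coFrame e X)ᴴ * Q ≠ 0 := fun h => by
    rw [coFrame_conjTranspose, Matrix.sub_mul, sub_eq_zero, Matrix.mul_assoc] at h
    have h1 : Q = graphFrame e X * ((inclLeft e)ᴴ * Q) := by
      have h2 := congrArg (· * Q) (incl_mul_conjTranspose_add e)
      simp only [Matrix.add_mul, Matrix.one_mul, Matrix.mul_assoc] at h2
      rw [h] at h2
      rw [graphFrame, Matrix.add_mul, Matrix.mul_assoc, h2]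
    have h3 : (1 : Matrix (Fin 3) (Fin 3) ℂ).rank ≤ 2 := by
      rw [← hQ]
      refine (rank_mul_le_right _ _).trans ?_
      rw [h1]
      refine (rank_mul_le_right _ _).trans ((rank_le_card_height _).trans ?_)
      simp
    rw [rank_one, Fintype.card_fin] at h3
    omega
  obtain ⟨i, j, hij⟩ : ∃ i j, ((coFrame e X)ᴴ * Q) i j ≠ 0 := by
    by_contra! h
    exact hY (Matrix.ext h)
  refine ⟨((coFrame e X)ᴴ * Q).submatrix id fun _ => j, fun h => hij ?_, ?_⟩
  · exact congrFun (congrFun h i) 0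
  · ext a b
    exact congrFun (congrFun hCY a) j

/-- Almost every constant Hermitian perturbation removes all degenerate crossings. -/
theorem exists_norm_lt_not_degenerate (U : Set E3)
    (h : E3 → Matrix (Fin (m + 2)) (Fin (m + 2)) ℂ)
    (B : E3 → Fin 3 → Matrix (Fin (m + 2)) (Fin (m + 2)) ℂ) (hh : ∀ x, (h x).IsHermitian)
    (hB : ∀ x ∈ U, ∀ ε, (jetMap (B x) ε).IsHermitian)
    (hd : ∀ x ∈ U, HasLinDeriv h (jetMap (B x)) x) {δ : ℝ} (hδ : 0 < δ) :
    ∃ R : Matrix (Fin (m + 2)) (Fin (m + 2)) ℝ, ‖R‖ < δ ∧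
      ∀ x ∈ U, ∀ c : ℝ, ¬ Degenerate c (h x + ofRealMatrix R) (B x) := by
  -- Φ takes the value R when h(x) + R is the chart matrix with parameters (c, X, C). The sets s
  -- below are the critical points, so it remains to show that a degeneracy makes R a critical
  -- value.
  let Φ : (Fin 2 ⊕ Fin m ≃ Fin (m + 2)) → ChartSpace m →
      Matrix (Fin (m + 2)) (Fin (m + 2)) ℝ := fun e p =>
    toRealMatrix (doubleMatrix e p - h p.2.2.2)
  let s : (Fin 2 ⊕ Fin m ≃ Fin (m + 2)) → Set (ChartSpace m) := fun e =>
    {p | ∃ D : ChartSpace m →ₗ[ℝ] Matrix (Fin (m + 2)) (Fin (m + 2)) ℝ,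
      HasLinDeriv (Φ e) D p ∧ ∃ v ≠ 0, D v = 0}
  obtain ⟨R, hRδ, hR⟩ := exists_norm_lt_notMem_critical (finrank_chartSpace m) Φ s
    (fun e x hx => hx) hδ
  have hΦ : ∀ e p, p.2.2.2 ∈ U → ∃ D, HasLinDeriv (Φ e) D p ∧ ∀ v,
      D v = toRealMatrix (doubleMatrixDeriv e p v - jetMap (B p.2.2.2) v.2.2.2) := fun e p hp => by
    obtain ⟨D, hD, hDv⟩ := hasLinDeriv_doubleMatrix e p
    let πx : ChartSpace m →ₗ[ℝ] E3 :=
      (LinearMap.snd ℝ _ _).comp ((LinearMap.snd ℝ _ _).comp (LinearMap.snd ℝ _ _))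
    have h1 : HasLinDeriv (fun q : ChartSpace m => h (πx q)) _ p :=
      HasLinDeriv.comp (hd p.2.2.2 hp) (HasLinDeriv.linear πx p)
    have h2 := HasLinDeriv.comp (HasLinDeriv.linear toRealMatrix _) (hD.sub h1)
    refine ⟨_, h2, fun v => ?_⟩
    rw [LinearMap.comp_apply, LinearMap.sub_apply, hDv]
    rfl
  refine ⟨R, hRδ, fun x hx c hdeg => ?_⟩
  have hM : (h x + ofRealMatrix R).IsHermitian := (hh x).add (isHermitian_ofRealMatrix R)
  have himg : ∀ e p, p.2.2.2 = x → doubleMatrix e p = h x + ofRealMatrix R → Φ e p = R :=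
    fun e p hp hF => by
      change toRealMatrix (doubleMatrix e p - h p.2.2.2) = R
      rw [hF, hp, add_sub_cancel_left, toRealMatrix_ofRealMatrix]
  rcases hdeg with ⟨Q, hQ, hMQ⟩ | ⟨Q, ε, hQ, hMQ, hε, hz⟩
  -- In the triple case any two of the three eigenvectors define the chart, and the third gives the
  -- kernel direction.
  · let ι : Fin 2 → Fin 3 := Fin.castSucc
    have hι : Function.Injective ι := Fin.castSucc_injective 2
    have hQ₂ : (Q.submatrix id ι)ᴴ * Q.submatrix id ι = 1 := by
      have h1 := congrArg (fun T => T.submatrix ι ι) hQ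
      simp only [submatrix_one ι hι] at h1
      exact h1
    have hMQ₂ : (h x + ofRealMatrix R) * Q.submatrix id ι = (c : ℂ) • Q.submatrix id ι :=
      congrArg (fun T => T.submatrix id ι) hMQ
    obtain ⟨e, X, R', S, hS, hF⟩ := exists_doubleMatrix_eq hM hQ₂ hMQ₂
    obtain ⟨D, hD, hDv⟩ := hΦ e (c, X, R', x) hx
    obtain ⟨X', hX', hCX'⟩ := exists_mul_eq_zero_of_triple hQ hMQ e X (hF x).symm
    refine hR e ⟨(c, X, R', x), ⟨D, hD, (0, X', 0, 0), fun h0 => hX' ?_, ?_⟩,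
      himg e _ rfl (hF x)⟩
    · exact congrArg (fun q : ChartSpace m => q.2.1) h0
    · rw [hDv, doubleMatrixDeriv_eq_zero e _ hCX', map_zero, sub_zero, map_zero]
  · obtain ⟨e, X, R', S, hS, hF⟩ := exists_doubleMatrix_eq hM hQ hMQ
    obtain ⟨D, hD, hDv⟩ := hΦ e (c, X, R', x) hx
    obtain ⟨a, ha⟩ := compression_eq_of_pauli_eq_zero (hB x hx ε) hz
    have hε0 : ε ≠ 0 := by
      rintro rfl
      simp at hε
    refine hR e ⟨(c, X, R', x), ⟨D, hD, exists_ne_zero_of_compression e (c, X, R', x) (hB x hx)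
      hε0 (a := a) ?_ hDv⟩, himg e _ rfl (hF x)⟩
    change (graphFrame e X)ᴴ * _ * graphFrame e X = a • ((graphFrame e X)ᴴ * graphFrame e X)
    rw [hS, conjTranspose_mul, Matrix.mul_assoc Sᴴ, Matrix.mul_assoc Sᴴ, ← Matrix.mul_assoc _ Q S,
      ha, Matrix.mul_assoc Sᴴ Qᴴ, ← Matrix.mul_assoc Qᴴ, hQ, Matrix.smul_mul, Matrix.mul_smul]

end ParametricSard

/-! ### Calculus on the slab -/

section SlabCalculus

variable {F : Type*} [NormedAddCommGroup F] [NormedSpace ℝ F]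

theorem norm_iteratedFDerivWithin_linearMap_le {f : E3 → F} (hf : ContDiffOn ℝ ∞ f slab)
    (L : F →ₗ[ℝ] F) {C : ℝ} (hC : 0 ≤ C) (hL : ∀ y, ‖L y‖ ≤ C * ‖y‖) (k : ℕ) {x : E3}
    (hx : x ∈ slab) :
    ‖iteratedFDerivWithin ℝ k (fun y => L (f y)) slab x‖ ≤
      C * ‖iteratedFDerivWithin ℝ k f slab x‖ := by
  have h := (L.mkContinuous C hL).norm_iteratedFDerivWithin_comp_left (hf x hx) uniqueDiffOn_slab
    hx (n := k) (by exact_mod_cast le_top)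
  exact h.trans (mul_le_mul_of_nonneg_right (L.mkContinuous_norm_le hC hL) (norm_nonneg _))

/-- Differentiating L ∘ f = f. With L the conjugate transpose, derivatives of Hermitian families are
Hermitian. -/
theorem linearMap_partialDeriv_eq [FiniteDimensional ℝ F] (L : F →ₗ[ℝ] F) {f : E3 → F}
    (hL : ∀ x, L (f x) = f x) {x : E3} (hx : x ∈ slab) (hf : DifferentiableWithinAt ℝ f slab x)
    (i : Fin 3) : L (partialDeriv f i x) = partialDeriv f i x := by
  have h1 := (LinearMap.toContinuousLinearMap L).hasFDerivAt.comp_hasFDerivWithinAt x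
    hf.hasFDerivWithinAt
  have h2 : (LinearMap.toContinuousLinearMap L : F → F) ∘ f = f := funext hL
  rw [h2] at h1
  have h3 := h1.fderivWithin (uniqueDiffOn_slab x hx)
  conv_rhs => rw [partialDeriv, h3]
  rfl

theorem partialDeriv_congr_add_const {f g : E3 → F} {x : E3} {c : F}
    (h : f =ᶠ[𝓝 x] fun y => g y + c) (i : Fin 3) : partialDeriv f i x = partialDeriv g i x := by
  rw [partialDeriv, (h.filter_mono nhdsWithin_le_nhds).fderivWithin_eq h.self_of_nhds,
    fderivWithin_add_const, partialDeriv]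

theorem hasLinDeriv_jetMap [FiniteDimensional ℝ F] {f : E3 → F} {x : E3}
    (hf : DifferentiableWithinAt ℝ f slab x) (hx : slab ∈ 𝓝 x) :
    HasLinDeriv f (jetMap fun i => partialDeriv f i x) x := by
  have h := hf.hasFDerivWithinAt.hasFDerivAt hx
  have e : LinearMap.toContinuousLinearMap (jetMap fun i => partialDeriv f i x) =
      fderivWithin ℝ f slab x := by
    refine ContinuousLinearMap.ext fun ε => ?_
    exact jetMap_clm (fderivWithin ℝ f slab x) ε
  rwa [HasLinDeriv, e]

end SlabCalculus

/-! ### Small perturbations with a cutoff in time -/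

section Perturb

variable {N : ℕ}

theorem contDiffOn_smul_const {F : Type*} [NormedAddCommGroup F] [NormedSpace ℝ F] {f : E3 → F}
    (hf : ContDiffOn ℝ ∞ f slab) {χ : ℝ → ℝ} (hχ : ContDiff ℝ ∞ χ) (S : F) :
    ContDiffOn ℝ ∞ (fun x => f x + χ (x 0) • S) slab := by
  have h0 : ContDiff ℝ ∞ fun x : E3 => x 0 := 
    (EuclideanSpace.proj (0 : Fin 3) : E3 →L[ℝ] ℝ).contDiff
  exact hf.add ((hχ.comp h0).smul contDiff_const).contDiffOn

/-- The family `H + χ(t) S`. -/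
noncomputable def perturb (H : CylinderFamily N) {χ : ℝ → ℝ} (hχ : ContDiff ℝ ∞ χ)
    (S : Herm N) : CylinderFamily N where
  toFun ζ := ⟨(H ζ).1 + χ ζ.1 • S.1, (H ζ).2.add (S.2.smul (IsSelfAdjoint.all _))⟩
  smooth := by
    refine (contDiffOn_smul_const (F := Matrix (Fin N) (Fin N) ℂ) H.smooth hχ S.1).congr ?_
    intro x hx
    have h : (Set.projIcc (0 : ℝ) 1 zero_le_one (x 0) : ℝ) = x 0 := by
      rw [Set.projIcc_of_mem zero_le_one hx]
    simp only [lift, h]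

variable {χ : ℝ → ℝ} (hχ : ContDiff ℝ ∞ χ)

theorem perturb_mat_sub (H : CylinderFamily N) (S : Herm N) (x : E3) :
    (perturb H hχ S).mat x - H.mat x = χ (Set.projIcc (0 : ℝ) 1 zero_le_one (x 0)) • S.1 :=
  add_sub_cancel_left _ _

theorem perturb_mat (H : CylinderFamily N) (S : Herm N) {x : E3} (hx : x ∈ slab) :
    (perturb H hχ S).mat x = H.mat x + χ (x 0) • S.1 := by
  have h := perturb_mat_sub hχ H S x
  rw [Set.projIcc_of_mem zero_le_one hx] at h
  rw [← h, add_sub_cancel]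

/-- The perturbation by S is the perturbation by the identity multiplied on the right by S, a linear
map of norm at most ‖S‖. So every norm is linear in ‖S‖, with a constant depending on k. -/
theorem ckNorm_perturb_le (H : CylinderFamily N) (S : Herm N) (k : ℕ) :
    ckNorm k (fun x => (perturb H hχ S).mat x - H.mat x) ≤
      ‖S.1‖ * ckNorm k (fun x => (perturb H hχ ⟨1, isHermitian_one⟩).mat x - H.mat x) := by
  have : Nonempty slab := ⟨⟨0, by simp [slab]⟩⟩
  let L : Matrix (Fin N) (Fin N) ℂ →ₗ[ℝ] Matrix (Fin N) (Fin N) ℂ := (mulBilin _ _ _).flip S.1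
  have hL : ∀ M, ‖L M‖ ≤ ‖S.1‖ * ‖M‖ := fun M => by
    rw [mul_comm]
    exact frobenius_norm_mul M S.1
  have e : (fun x => (perturb H hχ S).mat x - H.mat x) =
      fun x => L ((perturb H hχ ⟨1, isHermitian_one⟩).mat x - H.mat x) := by
    funext x
    rw [perturb_mat_sub, perturb_mat_sub, map_smul]
    exact congrArg _ (Matrix.one_mul S.1).symm
  refine ciSup_le fun ⟨x, hx⟩ => ?_
  have h1 := norm_iteratedFDerivWithin_linearMap_le (F := Matrix (Fin N) (Fin N) ℂ)
    (smooth_sub (perturb H hχ ⟨1, isHermitian_one⟩) H) L (norm_nonneg S.1) hL k hx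
  have h2 := le_ckNorm k (perturb H hχ ⟨1, isHermitian_one⟩) H x hx
  have h3 := hL ((perturb H hχ ⟨1, isHermitian_one⟩).mat x - H.mat x)
  have h4 := mul_le_mul_of_nonneg_left h2 (norm_nonneg S.1)
  rw [mul_add] at h4
  rw [e]
  exact (add_le_add h3 h1).trans h4

theorem div_one_add_le_div_one_add {s t : ℝ} (hs : 0 ≤ s) (h : s ≤ t) :
    s / (1 + s) ≤ t / (1 + t) := by
  rw [div_le_div_iff₀ (by linarith) (by linarith)]
  nlinarith

/-- The constants c k may grow arbitrarily; since t/(1 + t) ≤ 1, the geometric series dominates. -/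
theorem tendsto_tsum_geometric_div {c : ℕ → ℝ} (hc : ∀ k, 0 ≤ c k) :
    Tendsto (fun r : ℝ => ∑' k : ℕ, (2 : ℝ)⁻¹ ^ k * (r * c k / (1 + r * c k))) (𝓝[≥] 0) (𝓝 0) := by
  have h := tendsto_tsum_of_dominated_convergence (𝓕 := 𝓝[≥] (0 : ℝ))
    (f := fun (r : ℝ) (k : ℕ) => (2 : ℝ)⁻¹ ^ k * (r * c k / (1 + r * c k)))
    (g := fun _ => (0 : ℝ)) (bound := fun k => (2 : ℝ)⁻¹ ^ k)
    (summable_geometric_of_lt_one (by norm_num) (by norm_num)) (fun k => ?_) ?_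
  · simpa using h
  · have h1 : ContinuousAt (fun r : ℝ => (2 : ℝ)⁻¹ ^ k * (r * c k / (1 + r * c k))) 0 := by
      refine continuousAt_const.mul (ContinuousAt.div (by fun_prop) (by fun_prop) (by simp))
    have h2 := h1.tendsto
    simp only [zero_mul, add_zero, div_one, mul_zero] at h2
    exact h2.mono_left nhdsWithin_le_nhds
  · filter_upwards [self_mem_nhdsWithin] with r hr k
    have hr' : 0 ≤ r * c k := mul_nonneg hr (hc k)
    rw [Real.norm_of_nonneg (mul_nonneg (by positivity) (div_one_add_nonneg hr'))]
    exact mul_le_of_le_one_right (by positivity) (div_one_add_le_one hr')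

theorem exists_dist_perturb_lt (H : CylinderFamily N) {η : ℝ} (hη : 0 < η) :
    ∃ δ > 0, ∀ S : Herm N, ‖S.1‖ < δ → dist (perturb H hχ S) H < η := by
  let c : ℕ → ℝ := fun k =>
    ckNorm k (fun x => (perturb H hχ ⟨1, isHermitian_one⟩).mat x - H.mat x)
  have hc : ∀ k, 0 ≤ c k := fun k => ckNorm_nonneg _ _
  have h := (tendsto_tsum_geometric_div hc).eventually_lt_const hη
  obtain ⟨δ, hδ, h⟩ := Metric.mem_nhdsWithin_iff.1 h
  refine ⟨δ, hδ, fun S hS => lt_of_le_of_lt ?_ (h ⟨by simpa using hS, norm_nonneg S.1⟩)⟩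
  have hs : Summable fun k : ℕ => (2 : ℝ)⁻¹ ^ k * (‖S.1‖ * c k / (1 + ‖S.1‖ * c k)) := by
    refine Summable.of_nonneg_of_le (fun k => ?_) (fun k => ?_)
      (summable_geometric_of_lt_one (r := (2 : ℝ)⁻¹) (by norm_num) (by norm_num))
    · have := mul_nonneg (norm_nonneg S.1) (hc k)
      positivity
    · exact mul_le_of_le_one_right (by positivity)
        (div_one_add_le_one (mul_nonneg (norm_nonneg S.1) (hc k)))
  exact (summable_cinftyDist _ _).tsum_le_tsum (fun k => mul_le_mul_of_nonneg_left
    (div_one_add_le_div_one_add (ckNorm_nonneg _ _) (ckNorm_perturb_le hχ H S k))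
    (by positivity)) hs

end Perturb

/-! ### Density -/

section Density

variable {N : ℕ}

/-- The maximum of the spectral gap and the distance min(t, 1 - t) to the ends is positive
everywhere; m is its minimum on a compact set covering the cylinder. Closer than m to an end, the
gap must be the larger one. -/
theorem exists_gap_near_boundary {H₀ H₁ : TorusFamily N} {n : ℕ} (hn : 1 ≤ n) (hnN : n + 1 ≤ N)
    (hgap₀ : ∀ ξ : Torus, eigval (H₀ ξ) n < eigval (H₀ ξ) (n + 1))
    (hgap₁ : ∀ ξ : Torus, eigval (H₁ ξ) n < eigval (H₁ ξ) (n + 1))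
    {H : CylinderFamily N} (hH : H ∈ homotopies H₀ H₁) :
    ∃ m > 0, ∀ ζ : Cylinder, (ζ.1 : ℝ) < m ∨ 1 - m < (ζ.1 : ℝ) →
      m ≤ eigval (H ζ) (n + 1) - eigval (H ζ) n := by
  have hcont : Continuous fun x : slab => H (toCylinder x) :=
    continuous_fst.comp (continuous_jet.comp (continuous_const.prodMk continuous_id :
      Continuous fun x : slab => (H, x)))
  let f : slab → ℝ := fun x => max (eigval (H (toCylinder x)) (n + 1) - eigval (H (toCylinder x)) n)
    (min ((x : E3) 0) (1 - (x : E3) 0))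
  have hf : Continuous f := by
    refine Continuous.max ?_ (by fun_prop)
    exact ((continuous_eigval (n + 1)).comp hcont).sub ((continuous_eigval n).comp hcont)
  obtain ⟨x₀, -, hx₀⟩ := (isCompact_slab_norm_le (1 + 4 * Real.pi)).exists_isMinOn
    ⟨⟨0, by simp [slab]⟩, by simp; positivity⟩ hf.continuousOn
  have hpos : 0 < f x₀ := by
    rw [lt_max_iff, lt_min_iff, sub_pos, sub_pos]
    by_contra! hcon
    have hle := eigval_mono (H (toCylinder x₀)) hn (Nat.le_succ n) hnN
    have hc : Crosses n H (toCylinder x₀) := le_antisymm hle hcon.1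
    obtain ⟨h1, h2⟩ := crosses_interior hgap₀ hgap₁ hH hc
    rw [toCylinder_fst x₀.2] at h1 h2
    exact absurd h2 (not_lt.2 (hcon.2 h1))
  refine ⟨f x₀, hpos, fun ζ hζ => ?_⟩
  obtain ⟨x, hx, hxn, rfl⟩ := exists_toCylinder_eq_norm_le ζ
  have h1 : f x₀ ≤ f ⟨x, hx⟩ := hx₀ hxn
  rw [toCylinder_fst hx] at hζ
  refine (le_max_iff.1 h1).resolve_right fun h2 => ?_
  have h3 := le_min_iff.1 h2
  rcases hζ with h | h
  · exact absurd h3.1 (not_le.2 h)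
  · have := h3.2
    simp only at this
    linarith

theorem isHermitian_jetMap_mat (H : CylinderFamily N) {x : E3} (hx : x ∈ slab) (ε : E3) :
    (jetMap (fun i => partialDeriv H.mat i x) ε).IsHermitian := by
  have h : ∀ i, (partialDeriv H.mat i x)ᴴ = partialDeriv H.mat i x := fun i =>
    linearMap_partialDeriv_eq (conjTransposeReal _ _) (fun y => (H (toCylinder y)).2.eq) hx
      (H.differentiableOn x hx) i
  simp [IsHermitian, jetMap_apply, conjTranspose_sum, conjTranspose_smul, h]

theorem exists_mem_conicalHomotopies_dist_lt {H₀ H₁ : TorusFamily N} {n : ℕ} (hn : 1 ≤ n)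
    (hnN : n + 1 ≤ N) (hgap₀ : ∀ ξ : Torus, eigval (H₀ ξ) n < eigval (H₀ ξ) (n + 1))
    (hgap₁ : ∀ ξ : Torus, eigval (H₁ ξ) n < eigval (H₁ ξ) (n + 1)) (H : homotopies H₀ H₁)
    {η : ℝ} (hη : 0 < η) : ∃ H' ∈ conicalHomotopies n H₀ H₁, dist H' H < η := by
  obtain ⟨k, rfl⟩ : ∃ k, N = k + 2 := ⟨N - 2, by omega⟩
  obtain ⟨m, hm, hgap⟩ := exists_gap_near_boundary hn hnN hgap₀ hgap₁ H.2
  -- The cutoff equals 1 for δ < t < 1 - δ and vanishes at both ends. As δ < m, the strips where it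
  -- is not constant lie in the zone with gap at least m.
  let δ := min (m / 2) (1 / 4)
  have hδ : 0 < δ := by positivity
  have hδm : δ < m := (min_le_left _ _).trans_lt (by linarith)
  have hδ4 : δ ≤ 1 / 4 := min_le_right _ _
  let χ : ContDiffBump (1 / 2 : ℝ) := ⟨1 / 2 - δ, 1 / 2, by linarith, by linarith⟩
  have hχ : ContDiff ℝ ∞ χ := χ.contDiff
  have hχ0 : χ 0 = 0 := χ.zero_of_le_dist (by simp [χ, Real.dist_eq])
  have hχ1 : χ 1 = 0 := χ.zero_of_le_dist (by
    change (1 / 2 : ℝ) ≤ dist 1 (1 / 2)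
    rw [Real.dist_eq]
    norm_num)
  have hχin : ∀ t : ℝ, δ < t → t < 1 - δ → χ t = 1 := fun t h1 h2 => by
    refine χ.one_of_mem_closedBall ?_
    rw [Metric.mem_closedBall, Real.dist_eq, abs_le]
    change -(1 / 2 - δ) ≤ _ ∧ _ ≤ 1 / 2 - δ
    constructor <;> linarith
  obtain ⟨d, hd, hdist⟩ := exists_dist_perturb_lt hχ H.1 hη
  obtain ⟨C, hC⟩ := exists_bound_linearMap (ofRealMatrix (k := Fin (k + 2)))
  let U : Set E3 := {x | δ < x 0 ∧ x 0 < 1 - δ}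
  have h0 : Continuous fun x : E3 => x 0 := by fun_prop
  have hUopen : IsOpen U := (isOpen_lt continuous_const h0).inter (isOpen_lt h0 continuous_const)
  have hUslab : U ⊆ slab := fun x hx => ⟨by linarith [hx.1], by linarith [hx.2]⟩
  obtain ⟨R, hR, hgood⟩ := exists_norm_lt_not_degenerate U H.1.mat
    (fun x i => partialDeriv H.1.mat i x) (fun x => (H.1 (toCylinder x)).2)
    (fun x hx ε => isHermitian_jetMap_mat H.1 (hUslab hx) ε)
    (fun x hx => hasLinDeriv_jetMap (F := Matrix (Fin (k + 2)) (Fin (k + 2)) ℂ)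
      (H.1.differentiableOn x (hUslab hx)) (mem_of_superset (hUopen.mem_nhds hx) hUslab))
    -- C bounds the passage from R to S. The bound d controls the distance, and m/3 keeps the gap
    -- open: each of two eigenvalues moves by less than m/3.
    (δ := min d (m / 3) / (|C| + 1)) (by positivity)
  let S : Herm (k + 2) := ⟨ofRealMatrix R, isHermitian_ofRealMatrix R⟩
  have hS : ‖S.1‖ < min d (m / 3) := by
    have h1 := hC R
    have h2 : C * ‖R‖ ≤ |C| * ‖R‖ := mul_le_mul_of_nonneg_right (le_abs_self C) (norm_nonneg R)
    rw [lt_div_iff₀ (by positivity)] at hR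
    have h3 := norm_nonneg R
    change ‖ofRealMatrix R‖ < _
    linarith
  have hmem : perturb H.1 hχ S ∈ homotopies H₀ H₁ := by
    constructor
    · intro ξ
      rw [← H.2.1 ξ]
      refine Subtype.ext ?_
      change (H.1 _).1 + χ 0 • S.1 = _
      rw [hχ0, zero_smul, add_zero]
    · intro ξ
      rw [← H.2.2 ξ]
      refine Subtype.ext ?_
      change (H.1 _).1 + χ 1 • S.1 = _
      rw [hχ1, zero_smul, add_zero]
  refine ⟨⟨perturb H.1 hχ S, hmem⟩, ?_, hdist S (hS.trans_le (min_le_left _ _))⟩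
  rw [mem_conicalHomotopies_iff hn hnN hgap₀ hgap₁]
  rintro ⟨x, hx⟩ - ⟨hc, hdeg⟩
  -- Inside U the perturbation is the constant S, so Sard's choice applies with the derivatives
  -- unchanged. Outside U, Weyl's inequality leaves a positive gap and no crossing.
  by_cases hxU : x ∈ U
  · have hval : ∀ y ∈ U, (perturb H.1 hχ S).mat y = H.1.mat y + S.1 := fun y hy => by
      rw [perturb_mat hχ H.1 S (hUslab hy), hχin _ hy.1 hy.2, one_smul]
    have hpd : ∀ i, partialDeriv (perturb H.1 hχ S).mat i x = partialDeriv H.1.mat i x :=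
      partialDeriv_congr_add_const ((hUopen.eventually_mem hxU).mono hval)
    refine hgood x hxU (eigval (perturb H.1 hχ S (toCylinder x)) n) ?_
    have h1 : Degenerate (eigval (perturb H.1 hχ S (toCylinder x)) n)
        ((perturb H.1 hχ S).mat x) (fun i => partialDeriv (perturb H.1 hχ S).mat i x) := hdeg
    rwa [funext hpd, hval x hxU] at h1
  · have hζ : ((toCylinder x).1 : ℝ) < m ∨ 1 - m < ((toCylinder x).1 : ℝ) := by
      rw [toCylinder_fst hx]
      by_contra! hcon
      exact hxU ⟨by linarith [hcon.1], by linarith [hcon.2]⟩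
    have h1 := hgap _ hζ
    have h2 : ‖(perturb H.1 hχ S (toCylinder x)).1 - (H.1 (toCylinder x)).1‖ ≤ ‖S.1‖ := by
      have h3 := perturb_mat_sub hχ H.1 S x
      rw [CylinderFamily.mat_eq, CylinderFamily.mat_eq] at h3
      rw [h3, norm_smul, Real.norm_of_nonneg χ.nonneg]
      exact mul_le_of_le_one_left (norm_nonneg _) χ.le_one
    have h4 := abs_le.1 ((abs_eigval_sub_le (H.1 (toCylinder x))
      (perturb H.1 hχ S (toCylinder x)) n).trans h2)
    have h5 := abs_le.1 ((abs_eigval_sub_le (H.1 (toCylinder x))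
      (perturb H.1 hχ S (toCylinder x)) (n + 1)).trans h2)
    have h6 := hS.trans_le (min_le_right _ _)
    have hc' : eigval (perturb H.1 hχ S (toCylinder x)) n =
      eigval (perturb H.1 hχ S (toCylinder x)) (n + 1) := hc
    linarith [h4.2, h5.1]

end Density

end ConicalCrossings

theorem mainTheorem2 (N n : ℕ) (hn : 1 ≤ n) (hnN : n + 1 ≤ N)
    (H₀ H₁ : ConicalCrossings.TorusFamily N)
    (hgap₀ : ∀ ξ : ConicalCrossings.Torus,
      ConicalCrossings.eigval (H₀ ξ) n < ConicalCrossings.eigval (H₀ ξ) (n + 1))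
    (hgap₁ : ∀ ξ : ConicalCrossings.Torus,
      ConicalCrossings.eigval (H₁ ξ) n < ConicalCrossings.eigval (H₁ ξ) (n + 1)) :
    IsOpen (ConicalCrossings.conicalHomotopies n H₀ H₁) ∧
      Dense (ConicalCrossings.conicalHomotopies n H₀ H₁) := by
  refine ⟨ConicalCrossings.isOpen_conicalHomotopies hn hnN hgap₀ hgap₁, Metric.dense_iff.2 ?_⟩
  intro H r hr
  obtain ⟨H', hH', hd⟩ :=
    ConicalCrossings.exists_mem_conicalHomotopies_dist_lt hn hnN hgap₀ hgap₁ H hr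
  exact ⟨H', hd, hH'⟩
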